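/- **Conventions.** An sc-Banach space is a Banach space $E=E_0$ with a nested sequence of Banach spaces $E_0\supset E_1\supset\cdots$ such that the inclusions $E_n\to E_m$ ($m<n$) are compact and $E_\infty=\bigcap_m E_m$ is dense in every $E_m$; $E^k$ denotes the sc-space $(E^k)_m=E_{m+k}$. It is an sc-Hilbert space if all $E_m$ are Hilbert spaces. A map $f:U\to F$ is sc$^0$ if it restricts to continuous maps $U_m\to F_m$ for all $m$; it is sc$^1$ if moreover for each $x\in U_1$ there is $Df(x)\in L(E_0,F_0)$ with $\|f(x+h)-f(x)-Df(x)h\|_0=o(\|h\|_1)$ for $h\in E_1$, and $Tf(x,h)=(f(x),Df(x)h)$ is sc$^0$ from $TU=U^1\oplus E$ to $TF$; it is sc$^{k+1}$ if it is sc$^1$ and $Tf$ is sc$^k$. An sc-smooth splicing is a family of sc-projections $\pi_v:E\to E$, $v\in V$, with $V$ relatively open in a partial cone $[0,\infty)^k\times\mathbb R^{n-k}$ and $(v,e)\mapsto\pi_v(e)$ sc-smooth; its core is $K=\{(v,e):\pi_v(e)=e\}$. An M-polyfold $X$ is a second countable metrizable space with a maximal atlas of charts onto open subsets of splicing cores,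 with sc-smooth transition maps (smoothness being tested after composing with $(v,e)\mapsto(v,\pi_v(e))$). A strong M-polyfold bundle $\pi:Y\to X$ has local models $\{(v,e,h): \pi_v(e)=e,\ \sigma_v(h)=h\}$ with two splicings over the same $V$, the double filtration $Y_{m,k}$, $0\le k\le m+1$, and fibrewise linear transition maps which are sc-smooth both for $U\oplus H$ and for $U\oplus H^1$. A section is an sc$^+$-section if its principal parts are sc-smooth into $H^1$. The degeneration $d(x)$ is the number of vanishing cone coordinates of $x$ in a chart, $\partial X=\{d\ge1\}$, a face is the closure of a connected component of $\{d=1\}$, and $X$ is face-structured if every $x$ lies in exactly $d(x)$ faces. A section $f$ of $\pi$ is *Fredholm* if it is sc-smooth; $f(x)\in Y_{m,m+1}$ implies $x\in X_{m+1}$; and around every smooth point $q$ (on all levels), and around every point $q$ of $X$ on level $0$, it has the contraction germ property: in a strong bundle chart at $q$ there are a filled version $\hat f(v,u+u')=\bar f(v,u)+L(v,u)u'$ ($\pi_vu=u$, $\pi_vu'=0$, $L(v,u):\ker\pi_v\to\ker\sigma_v$ a linear sc-isomorphism), sc-smooth on a neighbourhood of the coordinates of $q$ in $V\oplus E$, and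 a local strong bundle isomorphism to $(B\oplus W)\triangleleft(\mathbb R^N\oplus W)$, with $B$ open in a partial cone, such that for the principal part $g$ of the push-forward of $\hat f$, the point $(\beta_0,\omega_0)$ corresponding to $q$ and the projection $P:\mathbb R^N\oplus W\to W$, $$Pg(\beta,\omega)-Pg(\beta_0,\omega_0)=(\omega-\omega_0)-\mathcal B(\beta,\omega),\qquad \|\mathcal B(\beta,\omega)-\mathcal B(\beta,\omega')\|_m\le\Theta_m\|\omega-\omega'\|_m$$ with some $\Theta_m\in(0,1)$, for $(\beta,\omega),(\beta,\omega')$ close to $(\beta_0,\omega_0)$ on level $m$ (for the levels $m$ under consideration). A *degeneration structure* $(S,R)$ is a set $S$ with $R\subset S^3$, whose elements are written $(A,B;C)$, such that, calling the replacement of an entry $C$ of a tuple by two entries $A,B$ with $(A,B;C)\in R$ a step: (1) for each $Z$ there are only finitely many sequences of steps starting at $(Z)$; (2) the set of two-step sequences from $(Z)$ to a given triple is empty or consists of exactly two elements, of the form $(Z)\to(A,B)\to(A,I,E)$ and $(Z)\to(A^*,E)\to(A,I,E)$; (3) if $(A,B;C),(A',B';C)\in R$ and $A=A'$ is not a target of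 a relator, or $B=B'$ is not a target of a relator, then $(A,B)=(A',B')$. An *operation* $\circ$ for a strong bundle $\pi:Y\to X$ over a face-structured M-polyfold consists of such an $(S,R)$, a partition of $X$ into nonempty open and closed sets $[A]$, $A\in S$ (for instance the connected components), and for each $(A,B;C)\in R$ an sc-diffeomorphism $\circ_C:[A]\times[B]\to[A,B;C]$ onto a closed subset of $[C]$ which is a union of faces, every face of $X$ lying in exactly one $[A,B;C]$, such that $d(a\circ_C b)=d(a)+d(b)+1$; $a\circ_D(b\circ_E c)=(a\circ_F b)\circ_D c$ for dual degeneration sequences; and $a\circ_E b=a'\circ_E b'$, $d(a)=d(a')$ with $a\in[A]$, $a'\in[A']$ imply $A=A'$. Moreover $\circ_C$ is covered by a strong bundle isomorphism consisting of linear isomorphisms $Y_a\oplus Y_b\to Y_{a\circ_C b}$. A section $f$ is $\circ$-compatible if $f(a\circ_C b)=f(a)\circ_C f(b)$ for all $(A,B;C)\in R$, $a\in[A]$, $b\in[B]$; a set $Q\subset X$ is $\circ$-compatible if $Q\cap\partial X=Q\circ Q:=\{a\circ_C b:\ (A,B;C)\in R,\ a\in Q\cap[A],\ b\in Q\cap[B]\}$.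 A section is *component-wise proper* if its zero set meets every connected component of $X$ in a compact set. An *auxiliary norm* is a continuous map $N:Y_{0,1}\to[0,\infty)$ which is a complete norm on every fibre of $Y_{0,1}\to X$ and satisfies: $N(h\circ_C k)=\max\{N(h),N(k)\}$; $N(y)\le\liminf N(y_k)$ whenever $y_k\to y$ in the mixed sense (in local coordinates the base points converge on level $0$ and the fibre parts converge weakly on level $1$ and strongly on level $0$); and, if $y_k\in Y_{0,1}$ lie over $x_k\to x$ in $X$ and $N(y_k)\to0$, then $y_k\to0_x$ in $Y_{0,1}$. **Theorem.** Let $\pi:Y\to X$ be a strong M-polyfold bundle, built on sc-Hilbert spaces, over a face-structured M-polyfold, with an operation $\circ$, let $f$ be a $\circ$-compatible, component-wise proper Fredholm section of $\pi$, and let $N$ be an auxiliary norm. Then there is an open set $U\supset f^{-1}(0)$ which is $\circ$-compatible, such that for every $\circ$-compatible sc$^+$-section $s$ of $\pi$ with support (the closure of $\{x : s(x)\neq 0\}$) contained in $U$ and with $N(s(x))\le1$ for all $x\in X$, the section $f+s$ is $\circ$-compatible and component-wise proper. -/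

import Mathlib

open Set Filter Topology
open scoped NNReal ENNReal

universe u v w

/-! # sc-Banach spaces and sc-smooth maps -/

/-- A Banach space `lev 0` with an sc-smooth structure: a nested sequence of Banach spaces `lev m`
with compact inclusions and such that the intersection of all levels is dense in every level.
The inclusion `lev n ⊆ lev m` is the injective map `incl`. -/
structure ScBanach where
  lev : ℕ → Type u
  [ng : ∀ m, NormedAddCommGroup (lev m)]
  [ns : ∀ m, NormedSpace ℝ (lev m)]
  [cs : ∀ m, CompleteSpace (lev m)]
  incl : ∀ {m n : ℕ}, m ≤ n → (lev n →L[ℝ] lev m)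
  incl_refl : ∀ (m : ℕ) (x : lev m), incl (le_refl m) x = x
  incl_trans : ∀ {k m n : ℕ} (h : k ≤ m) (h' : m ≤ n) (x : lev n),
    incl h (incl h' x) = incl (h.trans h') x
  incl_injective : ∀ {m n : ℕ} (h : m ≤ n), Function.Injective (incl h)
  incl_compact : ∀ {m n : ℕ} (h : m < n), IsCompactOperator (incl h.le)
  dense_infty : ∀ m, Dense {x : lev m | ∀ (n : ℕ) (h : m ≤ n), x ∈ range (incl h)}

attribute [instance] ScBanach.ng ScBanach.ns ScBanach.cs

namespace ScBanach

/-- The inclusion of level `m` into the underlying Banach space `lev 0`. -/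
abbrev ι (E : ScBanach.{u}) (m : ℕ) : E.lev m →L[ℝ] E.lev 0 := E.incl (Nat.zero_le m)

/-- All levels are Hilbert spaces (the norms satisfy the parallelogram identity). -/
def IsHilbert (E : ScBanach.{u}) : Prop := ∀ m, InnerProductSpaceable (E.lev m)

/-- The sc-space `E^k`, with levels `(E^k)_m = E_{m+k}`. -/
@[reducible] noncomputable def shift (E : ScBanach.{u}) (k : ℕ) : ScBanach.{u} where
  lev m := E.lev (m + k)
  incl h := E.incl (Nat.add_le_add_right h k)
  incl_refl m x := E.incl_refl _ x
  incl_trans h h' x := E.incl_trans _ _ x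
  incl_injective h := E.incl_injective _
  incl_compact h := E.incl_compact (Nat.add_lt_add_right h k)
  dense_infty m := by
    refine (E.dense_infty (m + k)).mono ?_
    intro x hx n h
    exact hx (n + k) (Nat.add_le_add_right h k)

/-- The direct sum `E ⊕ F`, with levels `E_m ⊕ F_m`. -/
@[reducible] noncomputable def prod (E : ScBanach.{u}) (F : ScBanach.{v}) : ScBanach.{max u v} where
  lev m := E.lev m × F.lev m
  incl h := (E.incl h).prodMap (F.incl h)
  incl_refl m x := Prod.ext (E.incl_refl m x.1) (F.incl_refl m x.2)
  incl_trans h h' x := Prod.ext (E.incl_trans h h' x.1) (F.incl_trans h h' x.2)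
  incl_injective h := (E.incl_injective h).prodMap (F.incl_injective h)
  incl_compact h := by
    obtain ⟨K, hK, hK'⟩ := E.incl_compact h
    obtain ⟨L, hL, hL'⟩ := F.incl_compact h
    exact ⟨K ×ˢ L, hK.prod hL, prod_mem_nhds hK' hL'⟩
  dense_infty m := by
    refine ((E.dense_infty m).prod (F.dense_infty m)).mono ?_
    rintro ⟨x, y⟩ ⟨hx, hy⟩ n h
    obtain ⟨x', hx'⟩ := hx n h
    obtain ⟨y', hy'⟩ := hy n h
    exact ⟨(x', y'), Prod.ext hx' hy'⟩

/-- The finite-dimensional space `ℝⁿ` with its constant (and only possible) sc-structure. -/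
@[reducible] noncomputable def euclid (n : ℕ) : ScBanach.{0} where
  lev _ := Fin n → ℝ
  incl _ := ContinuousLinearMap.id ℝ _
  incl_refl _ _ := rfl
  incl_trans _ _ _ := rfl
  incl_injective _ := Function.injective_id
  incl_compact _ := ⟨Metric.closedBall 0 1, isCompact_closedBall 0 1,
    Metric.closedBall_mem_nhds 0 one_pos⟩
  dense_infty _ := dense_univ.mono fun x _ _ _ => ⟨x, rfl⟩

/-- The tangent space `TE = E^1 ⊕ E`. -/
@[reducible] noncomputable def tangent (E : ScBanach.{u}) : ScBanach.{u} := (E.shift 1).prod E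

end ScBanach

/-- `f : U → F` is sc⁰: it maps `U_m = U ∩ E_m` to `F_m`, continuously for the topologies of the
levels `m`, for all `m`. -/
def ScZero (E : ScBanach.{u}) (F : ScBanach.{v}) (U : Set (E.lev 0)) (f : E.lev 0 → F.lev 0) :
    Prop :=
  ∀ m, ∃ fm : E.lev m → F.lev m, ContinuousOn fm {x | E.ι m x ∈ U} ∧
    ∀ x, E.ι m x ∈ U → F.ι m (fm x) = f (E.ι m x)

/-- The tangent `TU = U^1 ⊕ E` of a subset `U ⊆ E`. -/
def tangentSet (E : ScBanach.{u}) (U : Set (E.lev 0)) : Set (E.tangent.lev 0) :=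
  {p | E.ι 1 p.1 ∈ U}

/-- `g : TU → TF` is the tangent map `(x, h) ↦ (f x, Df(x) h)` of `f`, where
`Df(x) : E_0 → F_0` is, for `x ∈ U_1`, a bounded linear operator which is the derivative of `f`
at `x` with respect to increments in `E_1`. -/
def IsTangentMap (E : ScBanach.{u}) (F : ScBanach.{v}) (U : Set (E.lev 0))
    (f : E.lev 0 → F.lev 0) (g : E.tangent.lev 0 → F.tangent.lev 0) : Prop :=
  ∀ x : E.lev 1, E.ι 1 x ∈ U → ∃ A : E.lev 0 →L[ℝ] F.lev 0,
    (∀ h : E.lev 0, F.ι 1 (g (x, h)).1 = f (E.ι 1 x) ∧ (g (x, h)).2 = A h) ∧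
    (fun h : E.lev 1 => f (E.ι 1 (x + h)) - f (E.ι 1 x) - A (E.ι 1 h))
      =o[𝓝[{h | E.ι 1 (x + h) ∈ U}] 0] (fun h : E.lev 1 => h)

/-- `f : U → F` is of class sc^k. -/
def ScClass : ℕ → ∀ (E : ScBanach.{u}) (F : ScBanach.{v}) (_ : Set (E.lev 0))
    (_ : E.lev 0 → F.lev 0), Prop
  | 0, E, F, U, f => ScZero E F U f
  | k + 1, E, F, U, f => ScZero E F U f ∧ ∃ g : E.tangent.lev 0 → F.tangent.lev 0,
      IsTangentMap E F U f g ∧ ScClass k E.tangent F.tangent (tangentSet E U) g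

/-- `f : U → F` is sc-smooth. It is used for (relatively) open subsets `U` of `C ⊕ E` with a
partial cone `C` and an sc-Banach space `E`. -/
def ScSmooth (E : ScBanach.{u}) (F : ScBanach.{v}) (U : Set (E.lev 0))
    (f : E.lev 0 → F.lev 0) : Prop := ∀ k, ScClass k E F U f

/-- The fibre part `(x, h) ↦ g x h` of a map `U ◁ H → W ◁ H'` is sc_◁-smooth: it induces
sc-smooth maps `U ⊕ H → H'` and `U ⊕ H^1 → H'^1`. -/
def StrongSmooth (A : ScBanach.{u}) (H : ScBanach.{v}) (H' : ScBanach.{w}) (U : Set (A.lev 0))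
    (g : A.lev 0 → H.lev 0 → H'.lev 0) : Prop :=
  ScSmooth (A.prod H) H' {p | p.1 ∈ U} (fun p => g p.1 p.2) ∧
  ∃ g₁ : A.lev 0 → H.lev 1 → H'.lev 1,
    (∀ x ∈ U, ∀ h, H'.ι 1 (g₁ x h) = g x (H.ι 1 h)) ∧
    ScSmooth (A.prod (H.shift 1)) (H'.shift 1) {p | p.1 ∈ U} (fun p => g₁ p.1 p.2)

/-! # Splicings and M-polyfolds -/

/-- A (relatively) open subset `V` of a partial cone
`C = {v ∈ ℝⁿ | v_i ≥ 0 for i ∈ J}`; every partial cone has this form up to a linear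
isomorphism. -/
structure ParamDomain where
  n : ℕ
  J : Finset (Fin n)
  V : Set (Fin n → ℝ)
  isOpen_V : ∃ W : Set (Fin n → ℝ), IsOpen W ∧ V = W ∩ {v | ∀ i ∈ J, 0 ≤ v i}

/-- An sc-smooth splicing `(π, E, V)`. -/
structure ScSplicing (P : ParamDomain) where
  E : ScBanach.{v}
  π : (Fin P.n → ℝ) → E.lev 0 →L[ℝ] E.lev 0
  idem : ∀ v ∈ P.V, ∀ e, π v (π v e) = π v e
  smooth : ScSmooth ((ScBanach.euclid P.n).prod E) E {p | p.1 ∈ P.V} (fun p => π p.1 p.2)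

namespace ScSplicing

variable {P : ParamDomain} (S : ScSplicing.{v} P)

/-- The sc-space `ℝⁿ ⊕ E` containing the splicing core. -/
@[reducible] noncomputable def amb : ScBanach.{v} := (ScBanach.euclid P.n).prod S.E

/-- The retraction `(v, e) ↦ (v, π_v e)` of `V ⊕ E` onto the splicing core. -/
noncomputable def r (p : S.amb.lev 0) : S.amb.lev 0 := (p.1, S.π p.1 p.2)

/-- The splicing core `K = {(v, e) | v ∈ V, π_v e = e}`. -/
def core : Set (S.amb.lev 0) := {p | p.1 ∈ P.V ∧ S.π p.1 p.2 = p.2}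

end ScSplicing

/-- An M-polyfold chart: a homeomorphism from an open subset of `X` onto an open subset of a
splicing core. -/
structure MChart (X : Type u) [TopologicalSpace X] where
  P : ParamDomain
  S : ScSplicing.{v} P
  φ : PartialEquiv X (S.amb.lev 0)
  open_source : IsOpen φ.source
  open_target : ∃ W : Set (S.amb.lev 0), IsOpen W ∧ φ.target = W ∩ S.core
  continuousOn_φ : ContinuousOn φ φ.source
  continuousOn_symm : ContinuousOn φ.symm φ.target

namespace MChart

variable {X : Type u} [TopologicalSpace X] (c : MChart.{u, v} X)

/-- The relatively open subset `{(v, e) | (v, π_v e) ∈ φ(source)}` of `C ⊕ E` on which maps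
composed with the retraction are considered. -/
def dom : Set (c.S.amb.lev 0) := {p | p.1 ∈ c.P.V ∧ c.S.r p ∈ c.φ.target}

/-- The point of `X` with coordinates `(v, π_v e)`. -/
noncomputable def pt (p : c.S.amb.lev 0) : X := c.φ.symm (c.S.r p)

/-- The transition map from `c` to `c'`, composed with the retraction, is sc-smooth. -/
def SmoothTo (c' : MChart.{u, v} X) : Prop :=
  ScSmooth c.S.amb c'.S.amb {p | p ∈ c.dom ∧ c.pt p ∈ c'.φ.source} (fun p => c'.φ (c.pt p))

/-- sc-smooth compatibility of two charts. -/
def Compatible (c' : MChart.{u, v} X) : Prop := c.SmoothTo c' ∧ c'.SmoothTo c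

open Classical in
/-- The number of vanishing cone coordinates of a point in a chart. -/
noncomputable def deg (x : X) : ℕ := (c.P.J.filter fun i => (c.φ x).1 i = 0).card

end MChart

/-- An M-polyfold structure: a maximal atlas of sc-smoothly compatible charts. -/
structure MPolyfold (X : Type u) [TopologicalSpace X] where
  atlas : Set (MChart.{u, v} X)
  covers : ∀ x, ∃ c ∈ atlas, x ∈ c.φ.source
  compatible : ∀ c ∈ atlas, ∀ c' ∈ atlas, c.Compatible c'
  maximal : ∀ c : MChart.{u, v} X, (∀ c' ∈ atlas, c.Compatible c') → c ∈ atlas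

namespace MPolyfold

variable {X : Type u} [TopologicalSpace X] (M : MPolyfold.{u, v} X)

/-- `x` lies on level `m` of the induced filtration `X_m`. -/
def InLevel (m : ℕ) (x : X) : Prop :=
  ∃ c ∈ M.atlas, x ∈ c.φ.source ∧ c.φ x ∈ range (c.S.amb.ι m)

/-- `x` is a smooth point, i.e. `x ∈ X_∞`. -/
def IsSmoothPoint (x : X) : Prop := ∀ m, M.InLevel m x

/-- The degeneration map: the number of vanishing cone coordinates in a chart around `x`
(which does not depend on the chart; formally the least value is taken). -/
noncomputable def degen (x : X) : ℕ :=
  sInf {k | ∃ c ∈ M.atlas, x ∈ c.φ.source ∧ c.deg x = k}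

/-- The boundary `∂X`. -/
def boundary : Set X := {x | 1 ≤ M.degen x}

/-- A face: the closure of a connected component of `{x | d(x) = 1}`. -/
def IsFace (F : Set X) : Prop :=
  ∃ x, M.degen x = 1 ∧ F = closure (connectedComponentIn {y | M.degen y = 1} x)

/-- Every point `x` belongs to exactly `d(x)` many faces. -/
def FaceStructured : Prop := ∀ x, {F | M.IsFace F ∧ x ∈ F}.encard = M.degen x

end MPolyfold

/-! # Strong M-polyfold bundles -/

section Bundle

variable {X : Type u} [TopologicalSpace X] {Y : X → Type w}
  [∀ x, AddCommGroup (Y x)] [∀ x, Module ℝ (Y x)]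

/-- A strong bundle chart for the family of vector spaces `Y x`: over the domain of an M-polyfold
chart with splicing `(π, E, V)`, the fibre over the point with coordinates `(v, e)` is identified
(by `lin`) with the image of `σ_v`, for a second splicing `(σ, H, V)`. The map `inv` is the
inverse of this identification precomposed with the projection `σ_v`. -/
structure BChart (X : Type u) [TopologicalSpace X] (Y : X → Type w)
    [∀ x, AddCommGroup (Y x)] [∀ x, Module ℝ (Y x)] where
  base : MChart.{u, v} X
  T : ScSplicing.{v} base.P
  lin : ∀ x, Y x →ₗ[ℝ] T.E.lev 0
  inv : ∀ x, T.E.lev 0 →ₗ[ℝ] Y x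
  inv_lin : ∀ x ∈ base.φ.source, ∀ y, inv x (lin x y) = y
  lin_inv : ∀ x ∈ base.φ.source, ∀ h, lin x (inv x h) = T.π (base.φ x).1 h

namespace BChart

variable (c : BChart.{u, v, w} X Y)

/-- The sc-space `ℝⁿ ⊕ E` of the base. -/
@[reducible] noncomputable def A : ScBanach.{v} := c.base.S.amb

/-- The sc-space containing the fibres. -/
@[reducible] noncomputable def H : ScBanach.{v} := c.T.E

/-- The transition map from `c` to `c'`, composed with the projections, is sc_◁-smooth. -/
def SmoothTo (c' : BChart.{u, v, w} X Y) : Prop :=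
  StrongSmooth c.A c.H c'.H {p | p ∈ c.base.dom ∧ c.base.pt p ∈ c'.base.φ.source}
    (fun p h => c'.lin (c.base.pt p) (c.inv (c.base.pt p) h))

/-- The principal part of a section in a chart, composed with the retraction of the base. -/
noncomputable def rep (f : ∀ x, Y x) (p : c.A.lev 0) : c.H.lev 0 := c.lin (c.base.pt p) (f (c.base.pt p))

end BChart

/-- A strong M-polyfold bundle structure on the family of vector spaces `Y x`: a maximal atlas of
compatible strong bundle charts. The topologies and the double filtration of the total space are
those given by the charts. -/
structure StrongBundle (M : MPolyfold.{u, v} X) (Y : X → Type w)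
    [∀ x, AddCommGroup (Y x)] [∀ x, Module ℝ (Y x)] where
  atlas : Set (BChart.{u, v, w} X Y)
  base_mem : ∀ c ∈ atlas, c.base ∈ M.atlas
  covers : ∀ x, ∃ c ∈ atlas, x ∈ c.base.φ.source
  compatible : ∀ c ∈ atlas, ∀ c' ∈ atlas, c.SmoothTo c' ∧ c'.SmoothTo c
  maximal : ∀ c : BChart.{u, v, w} X Y, c.base ∈ M.atlas →
    (∀ c' ∈ atlas, c.SmoothTo c' ∧ c'.SmoothTo c) → c ∈ atlas

namespace StrongBundle

variable {M : MPolyfold.{u, v} X} (b : StrongBundle.{u, v, w} M Y)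

/-- The bundle is built on sc-Hilbert spaces. -/
def IsHilbert : Prop :=
  ∀ x, ∃ c ∈ b.atlas, x ∈ c.base.φ.source ∧ c.base.S.E.IsHilbert ∧ c.H.IsHilbert

/-- `y` has fibre regularity `k`. The space `Y_{m,k}`, for `0 ≤ k ≤ m + 1`, consists of the
vectors of fibre regularity `k` over points of `X_m`. -/
def InLevel (k : ℕ) {x : X} (y : Y x) : Prop :=
  ∃ c ∈ b.atlas, x ∈ c.base.φ.source ∧ c.lin x y ∈ range (c.H.ι k)

/-- sc-smooth sections. -/
def IsScSection (f : ∀ x, Y x) : Prop :=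
  ∀ c ∈ b.atlas, ScSmooth c.A c.H c.base.dom (c.rep f)

/-- sc⁺-sections: the principal parts are sc-smooth maps into `H^1`. -/
def IsScPlusSection (s : ∀ x, Y x) : Prop :=
  ∀ c ∈ b.atlas, ∃ s₁ : c.A.lev 0 → c.H.lev 1,
    (∀ p ∈ c.base.dom, c.H.ι 1 (s₁ p) = c.rep s p) ∧
    ScSmooth c.A (c.H.shift 1) c.base.dom s₁

/-- `f x ∈ Y_{m,m+1}` implies `x ∈ X_{m+1}`. -/
def IsRegularizing (f : ∀ x, Y x) : Prop :=
  ∀ m x, M.InLevel m x → b.InLevel (m + 1) (f x) → M.InLevel (m + 1) x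

/-- `fhat`, defined on `Ω ⊆ V ⊕ E`, is a filled version of the section `f` in the chart `c`:
`fhat(v, u + u') = f(v, u) + L(v, u) u'` for `π_v u = u`, `π_v u' = 0`, where
`L(v, u) : ker π_v → ker σ_v` is a linear sc-isomorphism. -/
def _root_.BChart.IsFilledVersion (c : BChart.{u, v, w} X Y) (f : ∀ x, Y x)
    (Ω : Set (c.A.lev 0)) (fhat : c.A.lev 0 → c.H.lev 0) : Prop :=
  ScSmooth c.A c.H Ω fhat ∧
  ∃ L : c.A.lev 0 → (c.base.S.E.lev 0 →L[ℝ] c.H.lev 0), ∀ p ∈ Ω,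
    fhat p = c.rep f p + L (c.base.S.r p) (p.2 - c.base.S.π p.1 p.2) ∧
    ∀ m, BijOn (L (c.base.S.r p))
      {e | e ∈ range (c.base.S.E.ι m) ∧ c.base.S.π p.1 e = 0}
      {h | h ∈ range (c.H.ι m) ∧ c.T.π p.1 h = 0}

/-- A local strong bundle isomorphism `Ω ◁ H → Ω' ◁ H'` between subsets `Ω`, `Ω'` of sc-spaces
`A`, `A'`: an sc-diffeomorphism `ψ : Ω → Ω'` of the base and linear isomorphisms of the fibres,
sc_◁-smooth in both directions. -/
structure _root_.LocalStrongIso (A : ScBanach.{u}) (H : ScBanach.{u}) (A' : ScBanach.{u})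
    (H' : ScBanach.{u}) where
  ψ : PartialEquiv (A.lev 0) (A'.lev 0)
  fib : A.lev 0 → (H.lev 0 ≃L[ℝ] H'.lev 0)
  smooth_ψ : ScSmooth A A' ψ.source ψ
  smooth_symm : ScSmooth A' A ψ.target ψ.symm
  smooth_fib : StrongSmooth A H H' ψ.source (fun p h => fib p h)
  smooth_fib_symm : StrongSmooth A' H' H ψ.target (fun q h => (fib (ψ.symm q)).symm h)

/-- The contraction germ property of the section `f` around `q`, with the contraction estimates
on the levels `m ∈ Λ`: in a strong bundle chart around `q` there is a filled version of `f` on a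
relatively open neighbourhood of the coordinates `p₀` of `q`, and a strong bundle isomorphism to
`(B ⊕ W) ◁ (R ⊕ W)`, with `B` open in a partial cone and `R` finite-dimensional, such that for the
principal part `g` of the push-forward, the map
`(β, ω) ↦ P g(β, ω) - P g(β₀, ω₀) = (ω - ω₀) - Bmap(β, ω)` is a contraction perturbation of the
identity near the image `(β₀, ω₀)` of `p₀`, on every level `m ∈ Λ`. -/
def HasContractionGerm (f : ∀ x, Y x) (q : X) (Λ : Set ℕ) : Prop :=
  ∃ c ∈ b.atlas, q ∈ c.base.φ.source ∧
  ∃ (Q : ParamDomain) (W : ScBanach.{v}) (n : ℕ)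
    (Ψ : LocalStrongIso c.A c.H ((ScBanach.euclid Q.n).prod W) ((ScBanach.euclid n).prod W))
    (fhat : c.A.lev 0 → c.H.lev 0),
    (∃ O : Set (c.A.lev 0), IsOpen O ∧ Ψ.ψ.source = O ∩ {p | p.1 ∈ c.base.P.V}) ∧
    (∃ O : Set (((ScBanach.euclid Q.n).prod W).lev 0), IsOpen O ∧
      Ψ.ψ.target = O ∩ {p | p.1 ∈ Q.V}) ∧
    Ψ.ψ.source ⊆ c.base.dom ∧
    c.base.φ q ∈ Ψ.ψ.source ∧
    c.IsFilledVersion f Ψ.ψ.source fhat ∧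
    ∀ m ∈ Λ, ∃ ω₀ : W.lev m, W.ι m ω₀ = (Ψ.ψ (c.base.φ q)).2 ∧
      ∃ Θ : ℝ, 0 < Θ ∧ Θ < 1 ∧ ∃ ε > 0,
        ∀ (β : Fin Q.n → ℝ) (ω ω' : W.lev m),
          (β, W.ι m ω) ∈ Ψ.ψ.target → (β, W.ι m ω') ∈ Ψ.ψ.target →
          ‖β - (Ψ.ψ (c.base.φ q)).1‖ < ε → ‖ω - ω₀‖ < ε → ‖ω' - ω₀‖ < ε →
          ∃ δ : W.lev m, ‖δ‖ ≤ Θ * ‖ω - ω'‖ ∧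
            (Ψ.fib (Ψ.ψ.symm (β, W.ι m ω)) (fhat (Ψ.ψ.symm (β, W.ι m ω)))).2
              - (Ψ.fib (Ψ.ψ.symm (β, W.ι m ω')) (fhat (Ψ.ψ.symm (β, W.ι m ω')))).2
              = W.ι m (ω - ω' - δ)

/-- Fredholm sections: sc-smooth, regularizing, with the contraction germ property on all levels
around smooth points, and on level `0` around every point. -/
def IsFredholm (f : ∀ x, Y x) : Prop :=
  b.IsScSection f ∧ b.IsRegularizing f ∧
  (∀ q, M.IsSmoothPoint q → b.HasContractionGerm f q univ) ∧
  (∀ q, b.HasContractionGerm f q {0})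

/-- Mixed convergence in `Y_{0,1}`: in a local chart, the base points converge on level `0`, and
the fibre parts converge weakly on level `1` and strongly on level `0`. -/
def MixedTendsto {x : ℕ → X} (y : ∀ k, Y (x k)) {a : X} (z : Y a) : Prop :=
  Tendsto x atTop (𝓝 a) ∧
  ∃ c ∈ b.atlas, a ∈ c.base.φ.source ∧ ∃ (h : ℕ → c.H.lev 1) (h' : c.H.lev 1),
    (∀ᶠ k in atTop, c.H.ι 1 (h k) = c.lin (x k) (y k)) ∧ c.H.ι 1 h' = c.lin a z ∧
    (∀ ℓ : c.H.lev 1 →L[ℝ] ℝ, Tendsto (fun k => ℓ (h k)) atTop (𝓝 (ℓ h'))) ∧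
    Tendsto (fun k => c.H.ι 1 (h k)) atTop (𝓝 (c.H.ι 1 h'))

/-- Convergence in `Y_{0,1}`. -/
def StrongTendsto {x : ℕ → X} (y : ∀ k, Y (x k)) {a : X} (z : Y a) : Prop :=
  Tendsto x atTop (𝓝 a) ∧
  ∃ c ∈ b.atlas, a ∈ c.base.φ.source ∧ ∃ (h : ℕ → c.H.lev 1) (h' : c.H.lev 1),
    (∀ᶠ k in atTop, c.H.ι 1 (h k) = c.lin (x k) (y k)) ∧ c.H.ι 1 h' = c.lin a z ∧
    Tendsto h atTop (𝓝 h')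

end StrongBundle

end Bundle

/-! # Degeneration structures -/

/-- A one-step degeneration: an occurring element `C` of the tuple `z` is replaced by two
elements `A, B` with `(A, B; C) ∈ R`. -/
def DegStep {S : Type u} (R : S → S → S → Prop) (z z' : List S) : Prop :=
  ∃ (l r : List S) (A B C : S), R A B C ∧ z = l ++ [C] ++ r ∧ z' = l ++ [A, B] ++ r

/-- A degeneration structure `(S, R)`; `R A B C` stands for `(A, B; C) ∈ R`. -/
structure DegenerationStructure (S : Type u) where
  R : S → S → S → Prop
  finiteness : ∀ Z, {c : List (List S) | c.head? = some [Z] ∧ c.IsChain (DegStep R)}.Finite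
  associativity : ∀ (Z : S) (t : List S),
    {z | DegStep R [Z] z ∧ DegStep R z t} = ∅ ∨
    ∃ A B A' I E, t = [A, I, E] ∧ R I E B ∧ R A I A' ∧ [A, B] ≠ [A', E] ∧
      {z | DegStep R [Z] z ∧ DegStep R z t} = {[A, B], [A', E]}
  minimality : ∀ A B A' B' C, R A B C → R A' B' C →
    ((A = A' ∧ ¬ ∃ U V, R U V A) ∨ (B = B' ∧ ¬ ∃ U V, R U V B)) → A = A' ∧ B = B'

/-! # Operations -/

section Operation

variable {X : Type u} [TopologicalSpace X] {Y : X → Type w}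
  [∀ x, AddCommGroup (Y x)] [∀ x, Module ℝ (Y x)] {M : MPolyfold.{u, v} X}

/-- An operation for a strong bundle `b` over a face-structured M-polyfold, indexed by a
degeneration structure `D` on `S`. The set `[A] = {x | idx x = A}` is the open and closed subspace
of `X` associated to `A ∈ S`; it need not be connected. The set `[A, B; C]` is the image of
`[A] × [B]` under `op A B C`. -/
structure Operation (b : StrongBundle.{u, v, w} M Y) {S : Type*} (D : DegenerationStructure S)
    where
  idx : X → S
  idx_surjective : Function.Surjective idx
  idx_locallyConstant : IsLocallyConstant idx
  /-- the map `(a, b) ↦ a ∘_C b` on `[A] × [B]` (values elsewhere are irrelevant) -/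
  op : S → S → S → X → X → X
  /-- the linear extension of the operation to the fibres -/
  fop : ∀ (A B C : S) (x y : X), (Y x × Y y) ≃ₗ[ℝ] Y (op A B C x y)
  idx_op : ∀ A B C, D.R A B C → ∀ x y, idx x = A → idx y = B → idx (op A B C x y) = C
  /-- `[A, B; C]` is a union of faces. -/
  face_union : ∀ A B C, D.R A B C → image2 (op A B C) (idx ⁻¹' {A}) (idx ⁻¹' {B}) =
    ⋃₀ {F | M.IsFace F ∧ F ⊆ image2 (op A B C) (idx ⁻¹' {A}) (idx ⁻¹' {B})}
  /-- Every face belongs to exactly one `[A, B; C]`. -/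
  face_index : ∀ F, M.IsFace F → ∃! r : S × S × S, D.R r.1 r.2.1 r.2.2 ∧
    F ⊆ image2 (op r.1 r.2.1 r.2.2) (idx ⁻¹' {r.1}) (idx ⁻¹' {r.2.1})
  /-- The degeneracy increases by one. -/
  degen_op : ∀ A B C, D.R A B C → ∀ x y, idx x = A → idx y = B →
    M.degen (op A B C x y) = M.degen x + M.degen y + 1
  /-- `[A] × [B] → [A, B; C]` is a homeomorphism onto a closed set, -/
  isClosedEmbedding_op : ∀ A B C, D.R A B C → IsClosedEmbedding
    (fun p : ↥(idx ⁻¹' {A}) × ↥(idx ⁻¹' {B}) => op A B C p.1 p.2)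
  /-- sc-smooth, and covered by a sc_◁-smooth map of the bundles, -/
  smooth_op : ∀ A B C, D.R A B C → ∀ c₁ ∈ b.atlas, ∀ c₂ ∈ b.atlas, ∀ c₃ ∈ b.atlas,
    let Ω : Set ((c₁.A.prod c₂.A).lev 0) :=
      {p | p.1 ∈ c₁.base.dom ∧ p.2 ∈ c₂.base.dom ∧ idx (c₁.base.pt p.1) = A ∧
        idx (c₂.base.pt p.2) = B ∧ op A B C (c₁.base.pt p.1) (c₂.base.pt p.2) ∈ c₃.base.φ.source}
    ScSmooth (c₁.A.prod c₂.A) c₃.A Ω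
      (fun p => c₃.base.φ (op A B C (c₁.base.pt p.1) (c₂.base.pt p.2))) ∧
    StrongSmooth (c₁.A.prod c₂.A) (c₁.H.prod c₂.H) c₃.H Ω
      (fun p h => c₃.lin (op A B C (c₁.base.pt p.1) (c₂.base.pt p.2))
        (fop A B C (c₁.base.pt p.1) (c₂.base.pt p.2)
          (c₁.inv (c₁.base.pt p.1) h.1, c₂.inv (c₂.base.pt p.2) h.2)))
  /-- and the same holds for the inverse, defined on `[A, B; C]` and its bundle: in charts it is
  locally the restriction of an sc-smooth, respectively sc_◁-smooth map. (Near each of its points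
  a face is given in suitable charts by the vanishing of one cone coordinate, and then this agrees
  with the smoothness for the induced M-polyfold structure of the face.) -/
  smooth_inverse : ∀ A B C, D.R A B C → ∀ x₀ y₀, idx x₀ = A → idx y₀ = B →
    ∃ c₁ ∈ b.atlas, ∃ c₂ ∈ b.atlas, ∃ c₃ ∈ b.atlas, x₀ ∈ c₁.base.φ.source ∧
    y₀ ∈ c₂.base.φ.source ∧ op A B C x₀ y₀ ∈ c₃.base.φ.source ∧
    ∃ (O : Set (c₃.A.lev 0)) (g₁ : c₃.A.lev 0 → c₁.A.lev 0) (g₂ : c₃.A.lev 0 → c₂.A.lev 0)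
      (k₁ : c₃.A.lev 0 → c₃.H.lev 0 → c₁.H.lev 0) (k₂ : c₃.A.lev 0 → c₃.H.lev 0 → c₂.H.lev 0),
      IsOpen O ∧ c₃.base.φ (op A B C x₀ y₀) ∈ O ∧
      ScSmooth c₃.A c₁.A (O ∩ c₃.base.dom) g₁ ∧ ScSmooth c₃.A c₂.A (O ∩ c₃.base.dom) g₂ ∧
      StrongSmooth c₃.A c₃.H c₁.H (O ∩ c₃.base.dom) k₁ ∧
      StrongSmooth c₃.A c₃.H c₂.H (O ∩ c₃.base.dom) k₂ ∧
      ∀ x y, idx x = A → idx y = B → x ∈ c₁.base.φ.source → y ∈ c₂.base.φ.source →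
        op A B C x y ∈ c₃.base.φ.source → c₃.base.φ (op A B C x y) ∈ O →
        g₁ (c₃.base.φ (op A B C x y)) = c₁.base.φ x ∧
        g₂ (c₃.base.φ (op A B C x y)) = c₂.base.φ y ∧
        ∀ (h : Y x) (k : Y y),
          k₁ (c₃.base.φ (op A B C x y)) (c₃.lin _ (fop A B C x y (h, k))) = c₁.lin x h ∧
          k₂ (c₃.base.φ (op A B C x y)) (c₃.lin _ (fop A B C x y (h, k))) = c₂.lin y k
  /-- associativity for dual degeneration sequences -/
  op_assoc : ∀ A B C E F Z, D.R B C E → D.R A E Z → D.R A B F → D.R F C Z →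
    ∀ x y z, idx x = A → idx y = B → idx z = C →
      op A E Z x (op B C E y z) = op F C Z (op A B F x y) z
  index_unique : ∀ A B A' B' Z, D.R A B Z → D.R A' B' Z → ∀ x y x' y', idx x = A → idx y = B →
    idx x' = A' → idx y' = B' → op A B Z x y = op A' B' Z x' y' → M.degen x = M.degen x' → A = A'

namespace Operation

variable {b : StrongBundle.{u, v, w} M Y} {S : Type*} {D : DegenerationStructure S}
  (O : Operation b D)

/-- `f(x ∘_C y) = f(x) ∘_C f(y)`. -/
def CompatibleSection (f : ∀ x, Y x) : Prop :=
  ∀ A B C, D.R A B C → ∀ x y, O.idx x = A → O.idx y = B →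
    f (O.op A B C x y) = O.fop A B C x y (f x, f y)

/-- The set `Q ∘ Q`. -/
def setOp (Q : Set X) : Set X :=
  {z | ∃ A B C x y, D.R A B C ∧ x ∈ Q ∧ O.idx x = A ∧ y ∈ Q ∧ O.idx y = B ∧ O.op A B C x y = z}

/-- `∂Q = Q ∘ Q`, where `∂Q = Q ∩ ∂X`. -/
def CompatibleSet (Q : Set X) : Prop := Q ∩ M.boundary = O.setOp Q

/-- Auxiliary norms. Only the values of `N` on `Y_{0,1}` matter. -/
structure IsAuxiliaryNorm (N : ∀ x, Y x → ℝ≥0) : Prop where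
  /-- `N` is continuous on `Y_{0,1}`. -/
  continuous : ∀ c ∈ b.atlas, ContinuousOn
    (fun p : c.A.lev 0 × c.H.lev 1 => N (c.base.φ.symm p.1)
      (c.inv (c.base.φ.symm p.1) (c.H.ι 1 p.2))) {p | p.1 ∈ c.base.φ.target}
  /-- On every fibre of `Y_{0,1}` it is a norm, -/
  eq_zero : ∀ x (y : Y x), b.InLevel 1 y → N x y = 0 → y = 0
  smul : ∀ x (t : ℝ) (y : Y x), b.InLevel 1 y → N x (t • y) = ‖t‖₊ * N x y
  triangle : ∀ x (y z : Y x), b.InLevel 1 y → b.InLevel 1 z → N x (y + z) ≤ N x y + N x z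
  /-- which is complete. -/
  complete : ∀ x (y : ℕ → Y x), (∀ k, b.InLevel 1 (y k)) →
    (∀ ε > 0, ∃ n₀, ∀ k ≥ n₀, ∀ l ≥ n₀, N x (y k - y l) < ε) →
    ∃ z : Y x, b.InLevel 1 z ∧ Tendsto (fun k => N x (y k - z)) atTop (𝓝 0)
  /-- The norms are compatible with the topology of `Y_{0,1}`. -/
  tendsto_zero : ∀ (x : ℕ → X) (y : ∀ k, Y (x k)) (a : X), (∀ k, b.InLevel 1 (y k)) →
    Tendsto x atTop (𝓝 a) → Tendsto (fun k => N (x k) (y k)) atTop (𝓝 0) →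
    b.StrongTendsto y (0 : Y a)
  /-- lower semicontinuity for mixed convergence -/
  lsc : ∀ (x : ℕ → X) (y : ∀ k, Y (x k)) (a : X) (z : Y a), (∀ k, b.InLevel 1 (y k)) →
    b.MixedTendsto y z →
    (N a z : ℝ≥0∞) ≤ liminf (fun k => (N (x k) (y k) : ℝ≥0∞)) atTop
  /-- `N(h ∘ k) = max{N(h), N(k)}` -/
  max : ∀ A B C, D.R A B C → ∀ x y, O.idx x = A → O.idx y = B → ∀ (h : Y x) (k : Y y),
    b.InLevel 1 h → b.InLevel 1 k →
    N _ (O.fop A B C x y (h, k)) = Max.max (N x h) (N y k)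

end Operation

/-- On every connected component of `X` the set of zeros of the section `f` is compact. -/
def ComponentwiseProper (f : ∀ x, Y x) : Prop :=
  ∀ x, IsCompact {y | y ∈ connectedComponent x ∧ f y = 0}

end Operation

/-! # Level-zero consequences of sc-smoothness -/

theorem ScBanach.ι_zero (E : ScBanach.{u}) (x : E.lev 0) : E.ι 0 x = x := E.incl_refl 0 x

/-- Differentiability plays no role in the argument: sc-smoothness enters only through class sc⁰ on
level zero. -/
theorem ScSmooth.continuousOn {E : ScBanach.{u}} {F : ScBanach.{v}} {U : Set (E.lev 0)}
    {f : E.lev 0 → F.lev 0} (h : ScSmooth E F U f) : ContinuousOn f U := by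
  obtain ⟨fm, hc, he⟩ := (h 0 : ScZero E F U f) 0
  simp only [ScBanach.ι_zero] at hc he
  exact hc.congr fun x hx => (he x hx).symm

theorem StrongSmooth.continuousOn {A : ScBanach.{u}} {H : ScBanach.{v}} {H' : ScBanach.{w}}
    {U : Set (A.lev 0)} {g : A.lev 0 → H.lev 0 → H'.lev 0} (h : StrongSmooth A H H' U g) :
    ContinuousOn (fun p : A.lev 0 × H.lev 0 => g p.1 p.2) {p | p.1 ∈ U} :=
  h.1.continuousOn

/-- Level zero of the shifted space `H^1` is `H.lev 1`, so the second half of strong smoothness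
yields continuity on level-one fibres over a base that still carries the level-zero topology. -/
theorem StrongSmooth.exists_continuousOn {A : ScBanach.{u}} {H : ScBanach.{v}} {H' : ScBanach.{w}}
    {U : Set (A.lev 0)} {g : A.lev 0 → H.lev 0 → H'.lev 0} (h : StrongSmooth A H H' U g) :
    ∃ g₁ : A.lev 0 → H.lev 1 → H'.lev 1,
      (∀ x ∈ U, ∀ h, H'.ι 1 (g₁ x h) = g x (H.ι 1 h)) ∧
      ContinuousOn (fun p : A.lev 0 × H.lev 1 => g₁ p.1 p.2) {p | p.1 ∈ U} := by
  obtain ⟨-, g₁, h₁, h₂⟩ := h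
  exact ⟨g₁, h₁, h₂.continuousOn⟩

/-- A fibrewise homogeneous strongly smooth map is locally uniformly bounded on the fibres of
level one. -/
theorem StrongSmooth.exists_bound {A : ScBanach.{u}} {H : ScBanach.{v}} {H' : ScBanach.{w}}
    {U : Set (A.lev 0)} {g : A.lev 0 → H.lev 0 → H'.lev 0} (h : StrongSmooth A H H' U g)
    (hg : ∀ x ∈ U, ∀ (t : ℝ) k, g x (t • k) = t • g x k) {p₀ : A.lev 0} (hp : p₀ ∈ U) (r : ℝ) :
    ∃ r' : ℝ, ∀ᶠ p in 𝓝[U] p₀, ∀ k : H.lev 1, ‖k‖ ≤ r →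
      ∃ k' : H'.lev 1, ‖k'‖ ≤ r' ∧ H'.ι 1 k' = g p (H.ι 1 k) := by
  obtain ⟨g₁, hg₁, hc⟩ := h.exists_continuousOn
  have hsmul : ∀ x ∈ U, ∀ (t : ℝ) k, g₁ x (t • k) = t • g₁ x k := fun x hx t k =>
    H'.incl_injective (Nat.zero_le 1) (by
      have := hg₁ x hx (t • k)
      rw [map_smul, hg x hx, ← hg₁ x hx] at this
      rw [this, map_smul])
  have h0 : g₁ p₀ 0 = 0 := by simpa using hsmul p₀ hp 0 0
  have hev : ∀ᶠ q : A.lev 0 × H.lev 1 in 𝓝[{q | q.1 ∈ U}] (p₀, 0), ‖g₁ q.1 q.2‖ < 1 := by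
    have := (hc (p₀, 0) hp).norm
    refine this.eventually (gt_mem_nhds ?_)
    simp [h0]
  have hset : {q : A.lev 0 × H.lev 1 | q.1 ∈ U} = U ×ˢ univ := by ext; simp
  rw [hset, nhdsWithin_prod_eq, nhdsWithin_univ] at hev
  obtain ⟨P, hP, Q, hQ, hPQ⟩ := eventually_prod_iff.1 hev
  obtain ⟨δ, hδ, hδQ⟩ := Metric.eventually_nhds_iff.1 hQ
  -- Multiplication by `t` moves the ball of radius `r` into the `δ`-ball on which `g₁` is bounded
  -- by one; homogeneity turns this into the bound `t⁻¹`. The denominator is positive for every real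
  -- `r`.
  obtain ⟨t, ht, htr⟩ : ∃ t : ℝ, 0 < t ∧ t * r < δ := by
    refine ⟨δ / (2 * (|r| + 1)), by positivity, ?_⟩
    have h1 : r < |r| + 1 := lt_of_le_of_lt (le_abs_self r) (by linarith)
    rw [div_mul_eq_mul_div, div_lt_iff₀ (by positivity)]
    nlinarith [abs_nonneg r]
  refine ⟨t⁻¹, ?_⟩
  filter_upwards [hP, self_mem_nhdsWithin] with p hpP hpU k hk
  refine ⟨g₁ p k, ?_, hg₁ p hpU k⟩
  have h1 : ‖g₁ p (t • k)‖ < 1 := by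
    refine hPQ hpP (hδQ ?_)
    rw [dist_zero_right, norm_smul, Real.norm_of_nonneg ht.le]
    exact lt_of_le_of_lt (mul_le_mul_of_nonneg_left hk ht.le) htr
  rw [hsmul p hpU, norm_smul, Real.norm_of_nonneg ht.le] at h1
  rw [← one_div, le_div_iff₀ ht]
  linarith

theorem ScSplicing.continuousOn_r {P : ParamDomain} (S : ScSplicing.{v} P) :
    ContinuousOn S.r {p | p.1 ∈ P.V} :=
  continuousOn_fst.prodMk S.smooth.continuousOn

theorem ScSplicing.r_of_mem_core {P : ParamDomain} (S : ScSplicing.{v} P) {p : S.amb.lev 0}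
    (hp : p ∈ S.core) : S.r p = p := Prod.ext rfl hp.2

theorem ScSplicing.r_mem_core {P : ParamDomain} (S : ScSplicing.{v} P) {p : S.amb.lev 0}
    (hp : p.1 ∈ P.V) : S.r p ∈ S.core := ⟨hp, S.idem _ hp _⟩

/-! ### Charts of M-polyfolds and local connectedness -/

namespace MChart

variable {X : Type u} [TopologicalSpace X] (c : MChart.{u, v} X)

theorem target_subset_core : c.φ.target ⊆ c.S.core := by
  obtain ⟨W, -, h⟩ := c.open_target
  rw [h]
  exact inter_subset_right

theorem r_map {x : X} (hx : x ∈ c.φ.source) : c.S.r (c.φ x) = c.φ x :=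
  c.S.r_of_mem_core (c.target_subset_core (c.φ.map_source hx))

theorem map_mem_dom {x : X} (hx : x ∈ c.φ.source) : c.φ x ∈ c.dom :=
  ⟨(c.target_subset_core (c.φ.map_source hx)).1, by
    rw [c.r_map hx]
    exact c.φ.map_source hx⟩

theorem pt_map {x : X} (hx : x ∈ c.φ.source) : c.pt (c.φ x) = x := by
  rw [pt, c.r_map hx, c.φ.left_inv hx]

theorem continuousOn_pt : ContinuousOn c.pt c.dom :=
  c.continuousOn_symm.comp (c.S.continuousOn_r.mono fun _ hp => hp.1) fun _ hp => hp.2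

theorem tendsto_map {x : X} (hx : x ∈ c.φ.source) : Tendsto c.φ (𝓝 x) (𝓝[c.dom] (c.φ x)) :=
  tendsto_nhdsWithin_iff.2 ⟨(c.continuousOn_φ.continuousAt (c.open_source.mem_nhds hx)),
    mem_of_superset (c.open_source.mem_nhds hx) fun _ hy => c.map_mem_dom hy⟩

/-- Small neighbourhoods of a point of a splicing core are images of convex sets. -/
theorem exists_preconnected_nhds {x : X} (hx : x ∈ c.φ.source) {U : Set X} (hU : U ∈ 𝓝 x) :
    ∃ V ∈ 𝓝 x, IsPreconnected V ∧ V ⊆ U := by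
  obtain ⟨W', hW', hV⟩ := c.P.isOpen_V
  obtain ⟨W, hW, htar⟩ := c.open_target
  have hcore := c.target_subset_core (c.φ.map_source hx)
  -- The retraction is continuous and fixes `c.φ x`, so nearby points of `V ⊕ E` are retracted into
  -- the chart target.
  have hdom : c.dom ∈ 𝓝[{p | p.1 ∈ c.P.V}] (c.φ x) := by
    have h1 : Tendsto c.S.r (𝓝[{p | p.1 ∈ c.P.V}] (c.φ x)) (𝓝 (c.φ x)) := by
      have := c.S.continuousOn_r (c.φ x) hcore.1
      rwa [ContinuousWithinAt, c.r_map hx] at this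
    have hxW : c.φ x ∈ W := (htar ▸ c.φ.map_source hx : c.φ x ∈ W ∩ c.S.core).1
    filter_upwards [h1 (hW.mem_nhds hxW), self_mem_nhdsWithin] with p hp hpV
    refine ⟨hpV, ?_⟩
    rw [htar]
    exact ⟨hp, c.S.r_mem_core hpV⟩
  have hpre : c.dom ∩ c.pt ⁻¹' U ∈ 𝓝[{p | p.1 ∈ c.P.V}] (c.φ x) := by
    refine inter_mem hdom ?_
    have h2 := c.continuousOn_pt (c.φ x) (c.map_mem_dom hx)
    rw [ContinuousWithinAt, c.pt_map hx] at h2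
    have h3 : 𝓝[{p : c.S.amb.lev 0 | p.1 ∈ c.P.V}] (c.φ x) = 𝓝[c.dom] (c.φ x) := by
      refine le_antisymm (nhdsWithin_le_of_mem hdom) (nhdsWithin_mono _ fun p hp => hp.1)
    rw [h3]
    exact h2 hU
  obtain ⟨O, hO, hOsub⟩ := mem_nhdsWithin_iff_exists_mem_nhds_inter.1 hpre
  have hO' : O ∩ {p : c.S.amb.lev 0 | p.1 ∈ W'} ∈ 𝓝 (c.φ x) :=
    inter_mem hO ((hW'.preimage continuous_fst).mem_nhds (hV ▸ hcore.1 : (c.φ x).1 ∈ W' ∩ _).1)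
  obtain ⟨ε, hε, hball⟩ := Metric.mem_nhds_iff.1 hO'
  -- A ball cut by the cone inequalities is convex, and `c.pt` carries it onto a neighbourhood of
  -- `x`, since core points are fixed by the retraction.
  set B : Set (c.S.amb.lev 0) :=
    Metric.ball (c.φ x) ε ∩ {p | ∀ i ∈ c.P.J, 0 ≤ p.1 i} with hB
  have hBconv : Convex ℝ B := by
    refine (convex_ball _ _).inter ?_
    intro p hp q hq s t hs ht _ i hi
    have h1 := mul_nonneg hs (hp i hi)
    have h2 := mul_nonneg ht (hq i hi)
    exact add_nonneg h1 h2
  have hBV : ∀ p ∈ B, p.1 ∈ c.P.V := fun p hp => by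
    rw [hV]
    exact ⟨(hball hp.1).2, hp.2⟩
  have hBsub : B ⊆ c.dom ∩ c.pt ⁻¹' U := fun p hp => hOsub ⟨(hball hp.1).1, hBV p hp⟩
  refine ⟨c.pt '' B, ?_, ?_, ?_⟩
  · have h1 : c.φ ⁻¹' Metric.ball (c.φ x) ε ∈ 𝓝 x :=
      c.continuousOn_φ.continuousAt (c.open_source.mem_nhds hx) (Metric.ball_mem_nhds _ hε)
    filter_upwards [h1, c.open_source.mem_nhds hx] with y hy hys
    refine ⟨c.φ y, ⟨hy, ?_⟩, c.pt_map hys⟩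
    have := (c.target_subset_core (c.φ.map_source hys)).1
    rw [hV] at this
    exact this.2
  · exact hBconv.isPreconnected.image _ (c.continuousOn_pt.mono fun p hp => (hBsub hp).1)
  · rintro _ ⟨p, hp, rfl⟩
    exact (hBsub hp).2

end MChart

/-- This makes connected components open, which the recursion over components relies on. -/
theorem MPolyfold.locallyConnectedSpace {X : Type u} [TopologicalSpace X]
    (M : MPolyfold.{u, v} X) : LocallyConnectedSpace X := by
  refine locallyConnectedSpace_iff_connected_subsets.2 fun x U hU => ?_
  obtain ⟨c, -, hx⟩ := M.covers x
  exact c.exists_preconnected_nhds hx hU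

/-! # Strong bundles in charts -/

namespace BChart

variable {X : Type u} [TopologicalSpace X] {Y : X → Type w}
  [∀ x, AddCommGroup (Y x)] [∀ x, Module ℝ (Y x)] (c : BChart.{u, v, w} X Y)

theorem lin_injective {x : X} (hx : x ∈ c.base.φ.source) : Function.Injective (c.lin x) :=
  Function.LeftInverse.injective (c.inv_lin x hx)

theorem rep_map (f : ∀ x, Y x) {x : X} (hx : x ∈ c.base.φ.source) :
    c.rep f (c.base.φ x) = c.lin x (f x) := by
  rw [rep, c.base.pt_map hx]

theorem transition_map (c' : BChart.{u, v, w} X Y) {x : X} (hx : x ∈ c.base.φ.source) (y : Y x) :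
    c'.lin (c.base.pt (c.base.φ x)) (c.inv (c.base.pt (c.base.φ x)) (c.lin x y)) =
      c'.lin x y := by
  rw [c.base.pt_map hx, c.inv_lin x hx]

end BChart

namespace StrongBundle

variable {X : Type u} [TopologicalSpace X] {Y : X → Type w}
  [∀ x, AddCommGroup (Y x)] [∀ x, Module ℝ (Y x)] {M : MPolyfold.{u, v} X}
  {b : StrongBundle.{u, v, w} M Y}

/-- Transition maps preserve fibre level one, so regularity witnessed in one chart can be read off
in every chart around the point. -/
theorem InLevel.exists_lin_eq {x : X} {y : Y x} (h : b.InLevel 1 y) {c : BChart.{u, v, w} X Y}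
    (hc : c ∈ b.atlas) (hx : x ∈ c.base.φ.source) : ∃ k : c.H.lev 1, c.H.ι 1 k = c.lin x y := by
  obtain ⟨c', hc', hx', k, hk⟩ := h
  obtain ⟨g₁, hg₁, -⟩ := (b.compatible c' hc' c hc).1.exists_continuousOn
  refine ⟨g₁ (c'.base.φ x) k, ?_⟩
  rw [hg₁ _ ⟨c'.base.map_mem_dom hx', by rwa [c'.base.pt_map hx']⟩, hk, c'.transition_map c hx']

theorem StrongTendsto.exists_lift {x : ℕ → X} {y : ∀ k, Y (x k)} {a : X} {z : Y a}
    (h : b.StrongTendsto y z) {c : BChart.{u, v, w} X Y} (hc : c ∈ b.atlas)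
    (ha : a ∈ c.base.φ.source) : ∃ (h : ℕ → c.H.lev 1) (h' : c.H.lev 1),
      (∀ᶠ k in atTop, c.H.ι 1 (h k) = c.lin (x k) (y k)) ∧ c.H.ι 1 h' = c.lin a z ∧
      Tendsto h atTop (𝓝 h') := by
  obtain ⟨hx, c', hc', ha', k, k', hk, hk', hlim⟩ := h
  obtain ⟨g₁, hg₁, hcont⟩ := (b.compatible c' hc' c hc).1.exists_continuousOn
  have hmem : ∀ᶠ n in atTop, x n ∈ c'.base.φ.source ∧ x n ∈ c.base.φ.source :=
    (hx.eventually_mem (c'.base.open_source.mem_nhds ha')).and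
      (hx.eventually_mem (c.base.open_source.mem_nhds ha))
  have hD : ∀ t : X, t ∈ c'.base.φ.source → t ∈ c.base.φ.source →
      c'.base.φ t ∈ {p | p ∈ c'.base.dom ∧ c'.base.pt p ∈ c.base.φ.source} := fun t h1 h2 =>
    ⟨c'.base.map_mem_dom h1, by rwa [c'.base.pt_map h1]⟩
  refine ⟨fun n => g₁ (c'.base.φ (x n)) (k n), g₁ (c'.base.φ a) k', ?_, ?_, ?_⟩
  · filter_upwards [hmem, hk] with n hn hkn
    rw [hg₁ _ (hD _ hn.1 hn.2), hkn, c'.transition_map c hn.1]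
  · rw [hg₁ _ (hD _ ha' ha), hk', c'.transition_map c ha']
  · refine Tendsto.comp (f := fun n => (c'.base.φ (x n), k n))
      (hcont (c'.base.φ a, k') (hD _ ha' ha)) (tendsto_nhdsWithin_iff.2 ⟨?_, ?_⟩)
    · exact ((tendsto_nhdsWithin_iff.1 (c'.base.tendsto_map ha')).1.comp hx).prodMk_nhds hlim
    · filter_upwards [hmem] with n hn using hD _ hn.1 hn.2

theorem tendsto_lin_of_continuousOn {f : ∀ x, Y x} {c : BChart.{u, v, w} X Y}
    (hf : ContinuousOn (c.rep f) c.base.dom) {a : X} (ha : a ∈ c.base.φ.source) :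
    Tendsto (fun x => c.lin x (f x)) (𝓝 a) (𝓝 (c.lin a (f a))) := by
  have h := Tendsto.comp (hf (c.base.φ a) (c.base.map_mem_dom ha)) (c.base.tendsto_map ha)
  rw [c.rep_map f ha] at h
  refine h.congr' ?_
  filter_upwards [c.base.open_source.mem_nhds ha] with x hx using c.rep_map f hx

theorem IsScSection.continuousOn_rep {f : ∀ x, Y x} (hf : b.IsScSection f)
    {c : BChart.{u, v, w} X Y} (hc : c ∈ b.atlas) : ContinuousOn (c.rep f) c.base.dom :=
  (hf c hc).continuousOn

theorem IsScPlusSection.continuousOn_rep {s : ∀ x, Y x} (hs : b.IsScPlusSection s)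
    {c : BChart.{u, v, w} X Y} (hc : c ∈ b.atlas) : ContinuousOn (c.rep s) c.base.dom := by
  obtain ⟨s₁, h₁, h₂⟩ := hs c hc
  exact ((c.H.ι 1).continuous.comp_continuousOn h₂.continuousOn).congr fun p hp => (h₁ p hp).symm

theorem IsScPlusSection.inLevel {s : ∀ x, Y x} (hs : b.IsScPlusSection s) (x : X) :
    b.InLevel 1 (s x) := by
  obtain ⟨c, hc, hx⟩ := b.covers x
  obtain ⟨s₁, h₁, -⟩ := hs c hc
  refine ⟨c, hc, hx, s₁ (c.base.φ x), ?_⟩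
  rw [h₁ _ (c.base.map_mem_dom hx), c.rep_map s hx]

theorem InLevel.smul {x : X} {y : Y x} {k : ℕ} (h : b.InLevel k y) (t : ℝ) :
    b.InLevel k (t • y) := by
  obtain ⟨c, hc, hx, e, he⟩ := h
  exact ⟨c, hc, hx, t • e, by rw [map_smul, map_smul, he]⟩

/-- The zero set of the sum of two continuous sections is closed. -/
theorem isClosed_zeros_add {f s : ∀ x, Y x} (hf : b.IsScSection f) (hs : b.IsScPlusSection s) :
    IsClosed {x | (f + s) x = 0} := by
  rw [← isOpen_compl_iff, isOpen_iff_mem_nhds]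
  intro a ha
  obtain ⟨c, hc, hac⟩ := b.covers a
  have hlim := (tendsto_lin_of_continuousOn (hf.continuousOn_rep hc) hac).add
    (tendsto_lin_of_continuousOn (hs.continuousOn_rep hc) hac)
  have hne : c.lin a (f a) + c.lin a (s a) ≠ 0 := by
    rw [← map_add]
    intro h
    exact ha (c.lin_injective hac (by rw [map_zero]; exact h))
  filter_upwards [hlim.eventually_ne hne] with x hx h0
  apply hx
  rw [← map_add, show f x + s x = 0 from h0, map_zero]

variable (b) in
/-- The set of points at which the value of the section `f` has fibre regularity one and norm
at most one. -/
def subunitSet (f : ∀ x, Y x) (N : ∀ x, Y x → ℝ≥0) : Set X :=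
  {x | b.InLevel 1 (f x) ∧ N x (f x) ≤ 1}

end StrongBundle

/-! ### Auxiliary norms, weak limits and closedness of the subunit set -/

namespace Operation.IsAuxiliaryNorm

variable {X : Type u} [TopologicalSpace X] {Y : X → Type w}
  [∀ x, AddCommGroup (Y x)] [∀ x, Module ℝ (Y x)] {M : MPolyfold.{u, v} X}
  {b : StrongBundle.{u, v, w} M Y} {S : Type*} {D : DegenerationStructure S}
  {O : Operation b D} {N : ∀ x, Y x → ℝ≥0}

theorem neg (hN : O.IsAuxiliaryNorm N) {x : X} {y : Y x} (hy : b.InLevel 1 y) :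
    N x (-y) = N x y := by
  simpa using hN.smul x (-1) y hy

/-- Vectors of norm at most one are locally uniformly bounded in the fibres of level one. -/
theorem exists_bound [FirstCountableTopology X] (hN : O.IsAuxiliaryNorm N)
    {c : BChart.{u, v, w} X Y} (hc : c ∈ b.atlas) {q : X} (hq : q ∈ c.base.φ.source) :
    ∃ r : ℝ, ∀ᶠ x in 𝓝 q, ∀ (y : Y x) (h : c.H.lev 1), c.H.ι 1 h = c.lin x y → N x y ≤ 1 →
      ‖h‖ ≤ r := by
  by_contra! hcon
  obtain ⟨u, hu⟩ := (𝓝 q).exists_antitone_basis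
  -- Counterexamples are normalized: divided by their level-one norm they have `N`-norm at most `1 /
  -- (n + 1)`, so `tendsto_zero` sends them to zero on level one, although their level-one norm is
  -- one.
  have hex : ∀ n : ℕ, ∃ x, x ∈ u n ∧ x ∈ c.base.φ.source ∧ ∃ (y : Y x) (h : c.H.lev 1),
      c.H.ι 1 h = c.lin x y ∧ N x y ≤ 1 ∧ (n : ℝ) + 1 < ‖h‖ := fun n => by
    obtain ⟨x, ⟨y, h, h1, h2, h3⟩, hx⟩ := ((hcon (n + 1)).and_eventually
      (inter_mem (hu.mem n) (c.base.open_source.mem_nhds hq))).exists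
    exact ⟨x, hx.1, hx.2, y, h, h1, h2, h3⟩
  choose x hxu hxs y h hy hyN hh using hex
  have hxq : Tendsto x atTop (𝓝 q) := hu.tendsto hxu
  have hpos : ∀ n, 0 < ‖h n‖ := fun n => lt_trans (by positivity) (hh n)
  have hlev : ∀ n, b.InLevel 1 (y n) := fun n => ⟨c, hc, hxs n, h n, hy n⟩
  have hNlim : Tendsto (fun n => N (x n) (‖h n‖⁻¹ • y n)) atTop (𝓝 0) := by
    rw [← NNReal.tendsto_coe]
    refine squeeze_zero (fun n => NNReal.coe_nonneg _) (fun n => ?_)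
      tendsto_one_div_add_atTop_nhds_zero_nat
    rw [hN.smul _ _ _ (hlev n), NNReal.coe_mul, coe_nnnorm, norm_inv, norm_norm, one_div]
    have h1 : (N (x n) (y n) : ℝ) ≤ 1 := by exact_mod_cast hyN n
    calc ‖h n‖⁻¹ * (N (x n) (y n) : ℝ) ≤ ‖h n‖⁻¹ * 1 := by gcongr
      _ ≤ ((n : ℝ) + 1)⁻¹ := by
        rw [mul_one]
        exact inv_anti₀ (by positivity) (hh n).le
  obtain ⟨k, k', hk, hk', hlim⟩ := (hN.tendsto_zero x (fun n => ‖h n‖⁻¹ • y n) q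
    (fun n => (hlev n).smul _) hxq hNlim).exists_lift hc hq
  have hk0 : k' = 0 := c.H.incl_injective (Nat.zero_le 1) (by
    rw [map_zero]
    exact hk'.trans (map_zero _))
  have hone : ∀ᶠ n in atTop, ‖k n‖ = 1 := by
    filter_upwards [hk] with n hn
    have : k n = ‖h n‖⁻¹ • h n := c.H.incl_injective (Nat.zero_le 1) (by
      rw [map_smul]
      refine hn.trans ?_
      rw [map_smul, hy n])
    rw [this, norm_smul, norm_inv, norm_norm, inv_mul_cancel₀ (hpos n).ne']
  have h1 : Tendsto (fun n => ‖k n‖) atTop (𝓝 0) := by simpa [hk0] using hlim.norm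
  exact zero_ne_one (tendsto_nhds_unique h1
    (tendsto_const_nhds.congr' (hone.mono fun n hn => hn.symm)))

end Operation.IsAuxiliaryNorm

/-- A bounded sequence in a Hilbert space whose image under an injective operator converges is
weakly convergent. -/
theorem exists_weak_limit_of_bounded {E F : Type*} [NormedAddCommGroup E] [NormedSpace ℝ E]
    [CompleteSpace E] [InnerProductSpaceable E] [NormedAddCommGroup F] [NormedSpace ℝ F]
    (T : E →L[ℝ] F) (hT : Function.Injective T) {h : ℕ → E} {r : ℝ} (hr : ∀ n, ‖h n‖ ≤ r) {y : F}
    (hy : Tendsto (fun n => T (h n)) atTop (𝓝 y)) :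
    ∃ h' : E, T h' = y ∧ ∀ ℓ : E →L[ℝ] ℝ, Tendsto (fun n => ℓ (h n)) atTop (𝓝 (ℓ h')) := by
  let _ : InnerProductSpace ℝ E :=
    InnerProductSpace.ofNorm ℝ InnerProductSpaceable.parallelogram_identity
  let R := InnerProductSpace.toDual ℝ E
  -- Along an ultrafilter, Banach–Alaoglu and the Riesz isomorphism produce a weak limit, and
  -- testing with `ℓ.comp T` identifies its image with `y`. As `T` is injective, all ultrafilters
  -- give the same limit, so the whole sequence converges weakly.
  have key : ∀ 𝒰 : Ultrafilter ℕ, (𝒰 : Filter ℕ) ≤ atTop → ∃ h' : E, T h' = y ∧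
      ∀ ℓ : E →L[ℝ] ℝ, Tendsto (fun n => ℓ (h n)) 𝒰 (𝓝 (ℓ h')) := fun 𝒰 h𝒰 => by
    have hK := WeakDual.isCompact_closedBall (𝕜 := ℝ) (E := E) 0 r
    obtain ⟨φ, -, hφ⟩ := isCompact_iff_ultrafilter_le_nhds.1 hK
      (𝒰.map fun n => (StrongDual.toWeakDual (R (h n)))) (by
        rw [le_principal_iff]
        refine Filter.mem_map.2 (Filter.univ_mem' fun n => ?_)
        simpa [R] using hr n)
    obtain ⟨h', hh'⟩ := R.surjective (WeakDual.toStrongDual φ)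
    have hlim : ∀ ℓ : E →L[ℝ] ℝ, Tendsto (fun n => ℓ (h n)) 𝒰 (𝓝 (ℓ h')) := fun ℓ => by
      obtain ⟨v, rfl⟩ := R.surjective ℓ
      have h1 : Tendsto (fun n => (StrongDual.toWeakDual (R (h n))) v) 𝒰 (𝓝 (φ v)) :=
        (WeakDual.eval_continuous v).continuousAt.tendsto.comp hφ
      have h2 : φ v = inner ℝ h' v := by
        have : φ v = (WeakDual.toStrongDual φ) v := rfl
        rw [this, ← hh']
        rfl
      rw [h2] at h1
      have h3 : ∀ e, R v e = inner ℝ e v := fun e =>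
        (InnerProductSpace.toDual_apply_apply).trans (real_inner_comm e v)
      simp only [h3]
      exact h1
    refine ⟨h', ?_, hlim⟩
    refine (SeparatingDual.eq_iff_forall_dual_eq (R := ℝ)).2 fun ℓ => ?_
    exact tendsto_nhds_unique (hlim (ℓ.comp T)) ((ℓ.continuous.tendsto _).comp (hy.mono_left h𝒰))
  obtain ⟨h', hh', -⟩ := key (Ultrafilter.of atTop) (Ultrafilter.of_le _)
  refine ⟨h', hh', fun ℓ => tendsto_iff_ultrafilter _ _ _ |>.2 fun 𝒰 h𝒰 => ?_⟩
  obtain ⟨k, hk, hlim⟩ := key 𝒰 h𝒰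
  rw [hT (hk.trans hh'.symm)] at hlim
  exact hlim ℓ

/-- For a convergent sequence in the set, the values of `f` converge on level zero and stay bounded
on level one. They therefore converge in the mixed sense, and `N` is lower semicontinuous for that
convergence. -/
theorem StrongBundle.isClosed_subunitSet {X : Type u} [TopologicalSpace X]
    [FirstCountableTopology X] {Y : X → Type w} [∀ x, AddCommGroup (Y x)] [∀ x, Module ℝ (Y x)]
    {M : MPolyfold.{u, v} X} {b : StrongBundle.{u, v, w} M Y} (hb : b.IsHilbert) {S : Type*}
    {D : DegenerationStructure S} {O : Operation b D} {N : ∀ x, Y x → ℝ≥0}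
    (hN : O.IsAuxiliaryNorm N) {f : ∀ x, Y x} (hf : b.IsScSection f) :
    IsClosed (b.subunitSet f N) := by
  refine IsSeqClosed.isClosed fun x a hx hxa => ?_
  obtain ⟨c, hc, ha, -, hH⟩ := hb a
  have hex : ∀ n, ∃ h : c.H.lev 1, x n ∈ c.base.φ.source → c.H.ι 1 h = c.lin (x n) (f (x n)) :=
    fun n => by
      by_cases hn : x n ∈ c.base.φ.source
      · obtain ⟨k, hk⟩ := (hx n).1.exists_lin_eq hc hn
        exact ⟨k, fun _ => hk⟩
      · exact ⟨0, fun h => absurd h hn⟩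
  choose h hh using hex
  obtain ⟨r, hr⟩ := hN.exists_bound hc ha
  have hsrc : ∀ᶠ n in atTop, x n ∈ c.base.φ.source := hxa (c.base.open_source.mem_nhds ha)
  have hbd : ∀ᶠ n in atTop, ‖h n‖ ≤ r := by
    filter_upwards [hxa.eventually hr, hsrc] with n hn hns using hn _ _ (hh n hns) (hx n).2
  -- The weak limit lemma needs the bound at every index, so the first `n₀` terms are dropped.
  obtain ⟨n₀, hn₀⟩ := eventually_atTop.1 (hbd.and hsrc)
  have hlin : Tendsto (fun n => c.H.ι 1 (h n)) atTop (𝓝 (c.lin a (f a))) := by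
    refine ((tendsto_lin_of_continuousOn (hf.continuousOn_rep hc) ha).comp hxa).congr' ?_
    filter_upwards [hsrc] with n hn using (hh n hn).symm
  have := hH 1
  obtain ⟨h', hh', hweak⟩ := exists_weak_limit_of_bounded (c.H.ι 1) (c.H.incl_injective _)
    (h := fun n => h (n + n₀)) (fun n => (hn₀ _ (Nat.le_add_left _ _)).1)
    (hlin.comp (tendsto_add_atTop_nat n₀))
  refine ⟨⟨c, hc, ha, h', hh'⟩, ?_⟩
  have hmix : b.MixedTendsto (fun n => f (x n)) (f a) :=
    ⟨hxa, c, hc, ha, h, h', hsrc.mono hh, hh',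
      fun ℓ => (tendsto_add_atTop_iff_nat n₀).1 (hweak ℓ), by rwa [hh']⟩
  have h1 := hN.lsc x (fun n => f (x n)) a (f a) (fun n => (hx n).1) hmix
  have h2 : liminf (fun n => (N (x n) (f (x n)) : ℝ≥0∞)) atTop ≤ 1 := by
    refine (liminf_le_liminf (v := fun _ => (1 : ℝ≥0∞)) ?_).trans (by simp)
    exact Eventually.of_forall fun n => by exact_mod_cast (hx n).2
  exact_mod_cast h1.trans h2

/-! # Local compactness -/

/-- A contractive perturbation of the identity is onto small balls. -/
theorem surjOn_closedBall_of_contraction {W : Type*} [NormedAddCommGroup W] [NormedSpace ℝ W]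
    [CompleteSpace W] {g : W → W} {ω₀ : W} {η Θ : ℝ} (hη : 0 ≤ η) (hΘ : 0 ≤ Θ)
    (hg : ∀ ω ∈ Metric.closedBall ω₀ η, ∀ ω' ∈ Metric.closedBall ω₀ η,
      ‖g ω - g ω' - (ω - ω')‖ ≤ Θ * ‖ω - ω'‖) :
    SurjOn g (Metric.closedBall ω₀ η) (Metric.closedBall (g ω₀) ((1 - Θ) * η)) := by
  lift Θ to ℝ≥0 using hΘ
  have happ : ApproximatesLinearOn g (ContinuousLinearMap.id ℝ W) (Metric.closedBall ω₀ η)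
      Θ := fun ω hω ω' hω' => hg ω hω ω' hω'
  -- The right inverse of the identity has norm one, which leaves the radius factor `1 - Θ`.
  let inv : (ContinuousLinearMap.id ℝ W).NonlinearRightInverse :=
    { toFun := id
      nnnorm := 1
      bound' := fun y => by simp
      right_inv' := fun y => rfl }
  have h := happ.surjOn_closedBall_of_nonlinearRightInverse inv hη Subset.rfl
  simpa [inv] using h

/-- If `G(β, ·)` is a contractive perturbation of the identity, then near the centre convergence
of the values of `G` implies convergence of the arguments. -/
theorem exists_nhds_ultrafilter_le_of_contraction (Q : ParamDomain) {W : Type*}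
    [NormedAddCommGroup W] [NormedSpace ℝ W] [CompleteSpace W] {U : Set ((Fin Q.n → ℝ) × W)}
    (hU : IsOpen U) {p₀ : (Fin Q.n → ℝ) × W} (hp₀ : p₀ ∈ U ∩ {p | p.1 ∈ Q.V})
    {G : (Fin Q.n → ℝ) × W → W} (hG : ContinuousOn G (U ∩ {p | p.1 ∈ Q.V})) {Θ ε : ℝ}
    (hΘ : 0 ≤ Θ) (hΘ1 : Θ < 1) (hε : 0 < ε)
    (hest : ∀ β ω ω', (β, ω) ∈ U ∩ {p | p.1 ∈ Q.V} → (β, ω') ∈ U ∩ {p | p.1 ∈ Q.V} →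
      ‖β - p₀.1‖ < ε → ‖ω - p₀.2‖ < ε → ‖ω' - p₀.2‖ < ε →
      ‖G (β, ω) - G (β, ω') - (ω - ω')‖ ≤ Θ * ‖ω - ω'‖) :
    ∃ P ∈ 𝓝 p₀, ∀ 𝒰 : Ultrafilter ((Fin Q.n → ℝ) × W), P ∩ (U ∩ {p | p.1 ∈ Q.V}) ∈ 𝒰 →
      (∃ ζ, Tendsto G 𝒰 (𝓝 ζ)) → ∃ p ∈ U ∩ {p | p.1 ∈ Q.V}, (𝒰 : Filter _) ≤ 𝓝 p := by
  obtain ⟨β₀, ω₀⟩ := p₀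
  obtain ⟨V', hV', hV⟩ := Q.isOpen_V
  have hβ₀ : β₀ ∈ V' ∩ {v | ∀ i ∈ Q.J, 0 ≤ v i} := hV ▸ hp₀.2
  obtain ⟨η₁, hη₁, hηU⟩ := Metric.nhds_basis_closedBall.mem_iff.1 (inter_mem (hU.mem_nhds hp₀.1)
    ((hV'.preimage continuous_fst).mem_nhds (hβ₀.1 : ((β₀, ω₀) : _ × W).1 ∈ V')))
  -- The closed `η`-balls must fit into the open `ε`-balls of the contraction estimate.
  set η := min η₁ (ε / 2) with hηdef
  have hη : 0 < η := lt_min hη₁ (by linarith)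
  have hηε : η < ε := lt_of_le_of_lt (min_le_right _ _) (by linarith)
  have hball : ∀ β ω, ‖β - β₀‖ ≤ η → ‖ω - ω₀‖ ≤ η → (∀ i ∈ Q.J, 0 ≤ β i) →
      (β, ω) ∈ U ∩ {p : (Fin Q.n → ℝ) × W | p.1 ∈ Q.V} := fun β ω h1 h2 h3 => by
    have h4 : ((β, ω) : (Fin Q.n → ℝ) × W) ∈ Metric.closedBall (β₀, ω₀) η₁ := by
      rw [Metric.mem_closedBall, Prod.dist_eq, dist_eq_norm, dist_eq_norm]
      exact max_le (h1.trans (min_le_left _ _)) (h2.trans (min_le_left _ _))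
    refine ⟨(hηU h4).1, ?_⟩
    change β ∈ Q.V
    rw [hV]
    exact ⟨(hηU h4).2, h3⟩
  -- `G (β, ·)` covers the ball of radius `(1 - Θ) * η` around `G (β, ω₀)`. One half of this radius
  -- is spent on the distance from `ζ` to `G (β₀, ω₀)`, the other on the distance from there to `G
  -- (β, ω₀)`.
  have hτ : 0 < (1 - Θ) * η / 2 := by
    have := mul_pos (sub_pos.2 hΘ1) hη
    linarith
  obtain ⟨η₂, hη₂, hGclose⟩ := Metric.continuousOn_iff.1 hG (β₀, ω₀) hp₀ _ hτ
  set η' := min η (η₂ / 2) with hη'def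
  have hη' : 0 < η' := lt_min hη (by linarith)
  have hη'₂ : η' < η₂ := lt_of_le_of_lt (min_le_right _ _) (by linarith)
  have hη'η : η' ≤ η := min_le_left _ _
  refine ⟨Metric.closedBall (β₀, ω₀) η', Metric.closedBall_mem_nhds _ hη', fun 𝒰 h𝒰 hζ => ?_⟩
  obtain ⟨ζ, hζ⟩ := hζ
  have hfst : ∀ p : (Fin Q.n → ℝ) × W, p ∈ Metric.closedBall (β₀, ω₀) η' →
      ‖p.1 - β₀‖ ≤ η' ∧ ‖p.2 - ω₀‖ ≤ η' := fun p hp => by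
    rw [Metric.mem_closedBall, Prod.dist_eq, dist_eq_norm, dist_eq_norm] at hp
    exact ⟨(le_max_left _ _).trans hp, (le_max_right _ _).trans hp⟩
  have hcone : IsClosed {v : Fin Q.n → ℝ | ∀ i ∈ Q.J, 0 ≤ v i} := by
    simp only [ofPred_forall]
    exact isClosed_biInter fun i _ => isClosed_le continuous_const (continuous_apply i)
  have hK : IsCompact (Metric.closedBall β₀ η' ∩ {v : Fin Q.n → ℝ | ∀ i ∈ Q.J, 0 ≤ v i}) :=
    (isCompact_closedBall β₀ η').inter_right hcone
  have hTcone : ∀ p ∈ U ∩ {p : (Fin Q.n → ℝ) × W | p.1 ∈ Q.V}, ∀ i ∈ Q.J, 0 ≤ p.1 i :=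
    fun p hp => (hV ▸ hp.2 : p.1 ∈ V' ∩ {v | ∀ i ∈ Q.J, 0 ≤ v i}).2
  -- The parameter is finite-dimensional and the partial cone is closed, so it converges along the
  -- ultrafilter by compactness. Only the `W`-component requires the contraction.
  obtain ⟨β, ⟨hββ₀, hβcone⟩, hβlim⟩ := isCompact_iff_ultrafilter_le_nhds.1 hK (𝒰.map Prod.fst) (by
    rw [le_principal_iff]
    refine Filter.mem_map.2 (mem_of_superset h𝒰 fun p hp => ⟨?_, hTcone p hp.2⟩)
    rw [Metric.mem_closedBall, dist_eq_norm]
    exact (hfst p hp.1).1)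
  rw [Metric.mem_closedBall, dist_eq_norm] at hββ₀
  have hclose : ∀ p ∈ Metric.closedBall (β₀, ω₀) η' ∩ (U ∩ {p | p.1 ∈ Q.V}),
      dist (G p) (G (β₀, ω₀)) ≤ (1 - Θ) * η / 2 := fun p hp =>
    (hGclose p hp.2 (lt_of_le_of_lt hp.1 hη'₂)).le
  have hζclose : dist ζ (G (β₀, ω₀)) ≤ (1 - Θ) * η / 2 :=
    le_of_tendsto (hζ.dist tendsto_const_nhds) (mem_of_superset h𝒰 hclose)
  have hβω₀ : dist (G (β, ω₀)) (G (β₀, ω₀)) ≤ (1 - Θ) * η / 2 := by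
    refine hclose _ ⟨?_, hball β ω₀ (hββ₀.trans hη'η) (by simpa using hη.le) hβcone⟩
    rw [Metric.mem_closedBall, Prod.dist_eq, dist_eq_norm]
    exact max_le hββ₀ (by simpa using hη'.le)
  have hestβ : ∀ β, ‖β - β₀‖ ≤ η → (∀ i ∈ Q.J, 0 ≤ β i) → ∀ ω ∈ Metric.closedBall ω₀ η,
      ∀ ω' ∈ Metric.closedBall ω₀ η,
      ‖G (β, ω) - G (β, ω') - (ω - ω')‖ ≤ Θ * ‖ω - ω'‖ := fun β h1 h2 ω hω ω' hω' => by
    rw [Metric.mem_closedBall, dist_eq_norm] at hω hω'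
    exact hest β ω ω' (hball β ω h1 hω h2) (hball β ω' h1 hω' h2) (h1.trans_lt hηε)
      (hω.trans_lt hηε) (hω'.trans_lt hηε)
  -- The candidate limit is found by solving `G (β, ω) = ζ` at the limit parameter.
  obtain ⟨ω, hω, hGω⟩ := surjOn_closedBall_of_contraction (g := fun ω => G (β, ω)) hη.le hΘ
    (hestβ β (hββ₀.trans hη'η) hβcone) (show ζ ∈ _ by
      rw [Metric.mem_closedBall]
      calc dist ζ (G (β, ω₀)) ≤ dist ζ (G (β₀, ω₀)) + dist (G (β, ω₀)) (G (β₀, ω₀)) :=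
            dist_triangle_right _ _ _
        _ ≤ (1 - Θ) * η := by linarith)
  have hωη : ‖ω - ω₀‖ ≤ η := by rwa [Metric.mem_closedBall, dist_eq_norm] at hω
  have hmem : (β, ω) ∈ U ∩ {p : (Fin Q.n → ℝ) × W | p.1 ∈ Q.V} :=
    hball β ω (hββ₀.trans hη'η) hωη hβcone
  refine ⟨(β, ω), hmem, ?_⟩
  have hβlim' : Tendsto (fun p : (Fin Q.n → ℝ) × W => p.1) 𝒰 (𝓝 β) := hβlim
  have hev : ∀ᶠ p : (Fin Q.n → ℝ) × W in 𝒰, ‖p.1 - β₀‖ ≤ η ∧ ‖p.2 - ω₀‖ ≤ η ∧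
      ∀ i ∈ Q.J, 0 ≤ p.1 i := mem_of_superset h𝒰 fun p hp =>
    ⟨(hfst p hp.1).1.trans hη'η, (hfst p hp.1).2.trans hη'η, hTcone p hp.2⟩
  have hGβ : Tendsto (fun p : (Fin Q.n → ℝ) × W => G (p.1, ω)) 𝒰 (𝓝 ζ) := by
    rw [← hGω]
    refine (hG (β, ω) hmem).tendsto.comp (f := fun p : (Fin Q.n → ℝ) × W => (p.1, ω))
      (tendsto_nhdsWithin_iff.2 ⟨hβlim'.prodMk_nhds tendsto_const_nhds, ?_⟩)
    filter_upwards [hev] with p hp using hball _ _ hp.1 hωη hp.2.2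
  -- Points with the same parameter are compared, so the contraction estimate bounds their distance
  -- by that of their values; both `G p` and `G (p.1, ω)` tend to `ζ`.
  have hdist : ∀ᶠ p : (Fin Q.n → ℝ) × W in 𝒰,
      ‖p.2 - ω‖ ≤ (1 - Θ)⁻¹ * ‖G p - G (p.1, ω)‖ := by
    filter_upwards [hev] with p hp
    have h1 := hestβ p.1 hp.1 hp.2.2 p.2 (by rw [Metric.mem_closedBall, dist_eq_norm]; exact hp.2.1)
      ω hω
    have h2 : ‖p.2 - ω‖ ≤ ‖G (p.1, p.2) - G (p.1, ω)‖ +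
        ‖G (p.1, p.2) - G (p.1, ω) - (p.2 - ω)‖ := by
      have := norm_sub_le (G (p.1, p.2) - G (p.1, ω)) (G (p.1, p.2) - G (p.1, ω) - (p.2 - ω))
      rwa [sub_sub_cancel] at this
    rw [inv_mul_eq_div, le_div_iff₀ (sub_pos.2 hΘ1)]
    linarith
  have hωlim : Tendsto (fun p : (Fin Q.n → ℝ) × W => p.2) 𝒰 (𝓝 ω) := by
    rw [tendsto_iff_norm_sub_tendsto_zero]
    refine squeeze_zero' (Eventually.of_forall fun _ => norm_nonneg _) hdist ?_
    have := ((hζ.sub hGβ).norm).const_mul (1 - Θ)⁻¹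
    simpa using this
  exact hβlim'.prodMk_nhds hωlim

/-- Near a point with the contraction germ property on level zero, the set of points with subunit
value is relatively compact. -/
theorem StrongBundle.HasContractionGerm.exists_nhds_ultrafilter {X : Type u} [TopologicalSpace X]
    [FirstCountableTopology X] {Y : X → Type w} [∀ x, AddCommGroup (Y x)] [∀ x, Module ℝ (Y x)]
    {M : MPolyfold.{u, v} X} {b : StrongBundle.{u, v, w} M Y} {S : Type*}
    {D : DegenerationStructure S} {O : Operation b D} {N : ∀ x, Y x → ℝ≥0}
    (hN : O.IsAuxiliaryNorm N) {f : ∀ x, Y x} {q : X} (hq : b.HasContractionGerm f q {0}) :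
    ∃ P ∈ 𝓝 q, ∀ 𝒰 : Ultrafilter X, P ∩ b.subunitSet f N ∈ 𝒰 → ∃ x, (𝒰 : Filter X) ≤ 𝓝 x := by
  obtain ⟨c, hc, hqs, Q, W, n, Ψ, fhat, ⟨O₁, hO₁, hsrc⟩, ⟨O₂, hO₂, htgt⟩, hdom, hqψ,
    ⟨hfhat, L, hL⟩, hgerm⟩ := hq
  obtain ⟨ω₀, hω₀, Θ, hΘ, hΘ1, ε, hε, hest⟩ := hgerm 0 rfl
  simp only [ScBanach.ι_zero] at hω₀ hest
  set p₀ := c.base.φ q with hp₀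
  have hfib : ContinuousOn (fun p : c.A.lev 0 × c.H.lev 0 => Ψ.fib p.1 p.2)
      {p | p.1 ∈ Ψ.ψ.source} := Ψ.smooth_fib.continuousOn
  have hψ : ContinuousOn Ψ.ψ Ψ.ψ.source := Ψ.smooth_ψ.continuousOn
  have hsymm : ContinuousOn Ψ.ψ.symm Ψ.ψ.target := Ψ.smooth_symm.continuousOn
  let G : (Fin Q.n → ℝ) × W.lev 0 → W.lev 0 := fun p =>
    (Ψ.fib (Ψ.ψ.symm p) (fhat (Ψ.ψ.symm p))).2
  have hG : ContinuousOn G Ψ.ψ.target := by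
    refine continuous_snd.comp_continuousOn ?_
    exact hfib.comp (f := fun p => (Ψ.ψ.symm p, fhat (Ψ.ψ.symm p)))
      (hsymm.prodMk (hfhat.continuousOn.comp hsymm fun p hp => Ψ.ψ.map_target hp))
      fun p hp => Ψ.ψ.map_target hp
  have hest' : ∀ β ω ω', (β, ω) ∈ O₂ ∩ {p | p.1 ∈ Q.V} → (β, ω') ∈ O₂ ∩ {p | p.1 ∈ Q.V} →
      ‖β - (Ψ.ψ p₀).1‖ < ε → ‖ω - (Ψ.ψ p₀).2‖ < ε → ‖ω' - (Ψ.ψ p₀).2‖ < ε →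
      ‖G (β, ω) - G (β, ω') - (ω - ω')‖ ≤ Θ * ‖ω - ω'‖ := fun β ω ω' h1 h2 h3 h4 h5 => by
    rw [← htgt] at h1 h2
    rw [← hω₀] at h4 h5
    obtain ⟨δ, hδ, heq⟩ := hest β ω ω' h1 h2 h3 h4 h5
    have : G (β, ω) - G (β, ω') - (ω - ω') = -δ := by
      refine (congrArg (fun t => t - (ω - ω')) heq).trans ?_
      abel
    rw [this, norm_neg]
    exact hδ
  obtain ⟨P, hP, hPlim⟩ := exists_nhds_ultrafilter_le_of_contraction Q hO₂
    (htgt ▸ Ψ.ψ.map_source hqψ) (htgt ▸ hG) hΘ.le hΘ1 hε hest'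
  obtain ⟨r, hr⟩ := hN.exists_bound hc hqs
  obtain ⟨r', hr'⟩ := Ψ.smooth_fib.exists_bound (fun x _ t k => map_smul (Ψ.fib x) t k) hqψ r
  have hφ : Tendsto c.base.φ (𝓝 q) (𝓝[Ψ.ψ.source] p₀) := by
    have h1 := c.base.tendsto_map hqs
    rw [tendsto_nhdsWithin_iff] at h1 ⊢
    refine ⟨h1.1, ?_⟩
    have h2 : O₁ ∈ 𝓝 p₀ := hO₁.mem_nhds (hsrc ▸ hqψ : p₀ ∈ O₁ ∩ _).1
    filter_upwards [h1.1 h2, h1.2] with x hx1 hx2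
    rw [hsrc]
    exact ⟨hx1, hx2.1⟩
  have hψφ : Tendsto (fun x => Ψ.ψ (c.base.φ x)) (𝓝 q) (𝓝 (Ψ.ψ p₀)) := (hψ p₀ hqψ).tendsto.comp hφ
  have hall : ∀ᶠ x in 𝓝 q, x ∈ c.base.φ.source ∧ c.base.φ x ∈ Ψ.ψ.source ∧
      Ψ.ψ (c.base.φ x) ∈ P ∧
      (∀ (y : Y x) (h : c.H.lev 1), c.H.ι 1 h = c.lin x y → N x y ≤ 1 → ‖h‖ ≤ r) ∧
      ∀ k : c.H.lev 1, ‖k‖ ≤ r → ∃ k' : ((ScBanach.euclid n).prod W).lev 1, ‖k'‖ ≤ r' ∧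
        ((ScBanach.euclid n).prod W).ι 1 k' = Ψ.fib (c.base.φ x) (c.H.ι 1 k) :=
    (c.base.open_source.eventually_mem hqs).and ((hφ.eventually self_mem_nhdsWithin).and
      ((hψφ.eventually_mem hP).and (hr.and (hφ.eventually hr'))))
  refine ⟨_, hall, fun 𝒰 h𝒰 => ?_⟩
  -- the values of the transported section lie in a compact set
  obtain ⟨K, hK, hKball⟩ : ∃ K : Set (((ScBanach.euclid n).prod W).lev 0), IsCompact K ∧
      ∀ k' : ((ScBanach.euclid n).prod W).lev 1, ‖k'‖ ≤ r' →
        ((ScBanach.euclid n).prod W).ι 1 k' ∈ K := by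
    obtain ⟨K, hK, hsub⟩ := (((ScBanach.euclid n).prod W).incl_compact
      Nat.zero_lt_one).image_subset_compact_of_bounded
      (S := Metric.closedBall (0 : ((ScBanach.euclid n).prod W).lev 1) r') Metric.isBounded_closedBall
    exact ⟨K, hK, fun k' hk' => hsub ⟨k', by simpa using hk', rfl⟩⟩
  have hval : ∀ᶠ x in 𝒰, Ψ.fib (c.base.φ x) (fhat (c.base.φ x)) ∈ K := by
    filter_upwards [h𝒰] with x hx
    obtain ⟨⟨hxs, hxψ, -, hx1, hx2⟩, hxlev, hxN⟩ := hx
    obtain ⟨h, hh⟩ := hxlev.exists_lin_eq hc hxs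
    obtain ⟨k', hk', hk'eq⟩ := hx2 h (hx1 _ h hh hxN)
    -- On the splicing core the filling term is `L` applied to zero, so the filled version agrees
    -- with `f`.
    have hrep : fhat (c.base.φ x) = c.H.ι 1 h := by
      rw [(hL _ hxψ).1, c.rep_map f hxs, hh]
      have h1 : c.base.S.π (c.base.φ x).1 (c.base.φ x).2 = (c.base.φ x).2 :=
        (c.base.target_subset_core (c.base.φ.map_source hxs)).2
      rw [h1, sub_self, map_zero, add_zero]
    rw [hrep, ← hk'eq]
    exact hKball k' hk'
  obtain ⟨z, -, hz⟩ := isCompact_iff_ultrafilter_le_nhds.1 hK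
    (𝒰.map fun x => Ψ.fib (c.base.φ x) (fhat (c.base.φ x))) (le_principal_iff.2 hval)
  obtain ⟨p, hp, hplim⟩ := hPlim (𝒰.map fun x => Ψ.ψ (c.base.φ x)) (by
      refine Filter.mem_map.2 (mem_of_superset h𝒰 fun x hx => ⟨hx.1.2.2.1, ?_⟩)
      rw [← htgt]
      exact Ψ.ψ.map_source hx.1.2.1) ⟨z.2, by
      refine tendsto_map'_iff.2 ?_
      have h1 : Tendsto (fun x => (Ψ.fib (c.base.φ x) (fhat (c.base.φ x))).2) 𝒰 (𝓝 z.2) :=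
        (continuous_snd.tendsto z).comp hz
      refine h1.congr' (mem_of_superset h𝒰 fun x hx => ?_)
      simp only [G, Function.comp, mem_ofPred_eq, Ψ.ψ.left_inv hx.1.2.1]⟩
  rw [← htgt] at hp
  refine ⟨c.base.pt (Ψ.ψ.symm p), ?_⟩
  have h1 : Tendsto (fun x => Ψ.ψ (c.base.φ x)) 𝒰 (𝓝[Ψ.ψ.target] p) :=
    tendsto_nhdsWithin_iff.2 ⟨hplim, mem_of_superset h𝒰 fun x hx => Ψ.ψ.map_source hx.1.2.1⟩
  have h2 : Tendsto (fun x => c.base.pt (Ψ.ψ.symm (Ψ.ψ (c.base.φ x)))) 𝒰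
      (𝓝 (c.base.pt (Ψ.ψ.symm p))) :=
    ((c.base.continuousOn_pt.comp hsymm fun y hy => hdom (Ψ.ψ.map_target hy)) p hp).tendsto.comp h1
  refine tendsto_id'.1 (h2.congr' (mem_of_superset h𝒰 fun x hx => ?_))
  simp only [mem_ofPred_eq, Ψ.ψ.left_inv hx.1.2.1, c.base.pt_map hx.1.1, id]

/-- A closed set such that near every point ultrafilters on it converge is locally compact. -/
theorem exists_open_nhds_of_isCompact {X : Type*} [TopologicalSpace X] [RegularSpace X]
    {A : Set X} (hA : IsClosed A)
    (hloc : ∀ q, ∃ P ∈ 𝓝 q, ∀ 𝒰 : Ultrafilter X, P ∩ A ∈ 𝒰 → ∃ x, (𝒰 : Filter X) ≤ 𝓝 x)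
    {L : Set X} (hL : IsCompact L) :
    ∃ V, IsOpen V ∧ L ⊆ V ∧ ∃ K, IsCompact K ∧ V ∩ A ⊆ K := by
  refine hL.induction_on (p := fun L => ∃ V, IsOpen V ∧ L ⊆ V ∧ ∃ K, IsCompact K ∧ V ∩ A ⊆ K)
    ⟨∅, isOpen_empty, Subset.rfl, ∅, isCompact_empty, by simp⟩
    (fun s t hst ⟨V, hV, hsub, h⟩ => ⟨V, hV, hst.trans hsub, h⟩)
    (fun s t ⟨V, hV, hsub, K, hK, hVK⟩ ⟨V', hV', hsub', K', hK', hVK'⟩ =>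
      ⟨V ∪ V', hV.union hV', union_subset_union hsub hsub', K ∪ K', hK.union hK', by
        rw [union_inter_distrib_right]
        exact union_subset_union hVK hVK'⟩) fun q _ => ?_
  obtain ⟨P, hP, hPlim⟩ := hloc q
  -- By regularity `P` is shrunk to a closed neighbourhood, so that limits of ultrafilters on `C ∩
  -- A` remain there.
  obtain ⟨C, hC, hCcl, hCP⟩ := exists_mem_nhds_isClosed_subset hP
  refine ⟨interior C, mem_nhdsWithin_of_mem_nhds (interior_mem_nhds.2 hC), interior C,
    isOpen_interior, Subset.rfl, C ∩ A, ?_, inter_subset_inter_left _ interior_subset⟩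
  refine isCompact_iff_ultrafilter_le_nhds.2 fun 𝒰 h𝒰 => ?_
  rw [le_principal_iff] at h𝒰
  obtain ⟨x, hx⟩ := hPlim 𝒰 (mem_of_superset h𝒰 (inter_subset_inter_left _ hCP))
  exact ⟨x, (hCcl.inter hA).mem_of_tendsto (f := id) hx h𝒰, hx⟩

/-! # Degeneration structures -/

theorem degStep_singleton {S : Type u} {R : S → S → S → Prop} {Z A B : S}
    (h : DegStep R [Z] [A, B]) : R A B Z := by
  obtain ⟨l, r, A', B', C, hR, h1, h2⟩ := h
  cases l with
  | nil => simp_all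
  | cons a l => simp at h1

theorem DegStep.append {S : Type u} {R : S → S → S → Prop} {z z' : List S} (h : DegStep R z z')
    (p s : List S) : DegStep R (p ++ z ++ s) (p ++ z' ++ s) := by
  obtain ⟨l, r, A, B, C, hR, rfl, rfl⟩ := h
  exact ⟨p ++ l, r ++ s, A, B, C, hR, by simp, by simp⟩

namespace DegenerationStructure

variable {S : Type u} (D : DegenerationStructure S)

/-- `A` occurs in a one-step degeneration of `C`. -/
def Below (A C : S) : Prop := ∃ B, D.R A B C ∨ D.R B A C

variable {D} in
theorem below_left {A B C : S} (h : D.R A B C) : D.Below A C := ⟨B, Or.inl h⟩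

variable {D} in
theorem below_right {A B C : S} (h : D.R A B C) : D.Below B C := ⟨A, Or.inr h⟩

/-- A chain of degenerations of a factor of `Z` becomes a chain from `Z`, one step longer, when the
other factor is carried along. Finiteness bounds the lengths of the chains from `Z`, and the
induction is on this bound. -/
theorem wellFounded_below : WellFounded D.Below := by
  have key : ∀ (n : ℕ) (Z : S), (∀ c : List (List S), c.head? = some [Z] →
      c.IsChain (DegStep D.R) → c.length ≤ n) → Acc D.Below Z := by
    intro n
    induction n with
    | zero => exact fun Z h => absurd (h [[Z]] rfl (by simp)) (by simp)
    | succ n ih =>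
      refine fun Z h => ⟨Z, fun A hA => ih A fun c hc hchain => ?_⟩
      have aux : ∀ p s : List S, DegStep D.R [Z] (p ++ [A] ++ s) → c.length ≤ n := by
        intro p s hps
        have := h ([Z] :: c.map fun z => p ++ z ++ s) rfl (by
          refine List.isChain_cons.2 ⟨?_, (List.isChain_map _).2 (hchain.imp
            fun _ _ hstep => hstep.append p s)⟩
          intro t ht
          rw [List.head?_map, hc] at ht
          simp only [Option.map_some, Option.mem_def, Option.some.injEq] at ht
          rw [← ht]
          exact hps)
        simpa using this
      obtain ⟨B, hB | hB⟩ := hA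
      · exact aux [] [B] ⟨[], [], A, B, Z, hB, rfl, rfl⟩
      · exact aux [B] [] ⟨[], [], B, A, Z, hB, rfl, rfl⟩
  refine ⟨fun Z => ?_⟩
  obtain ⟨n, hn⟩ := ((D.finiteness Z).image List.length).bddAbove
  exact key n Z fun c hc hchain => hn (mem_image_of_mem _ ⟨hc, hchain⟩)

/-- Relators with target `C` are two-term chains starting at `[C]`, of which there are finitely
many. -/
theorem finite_relators (C : S) : {r : S × S | D.R r.1 r.2 C}.Finite := by
  refine Finite.of_finite_image (f := fun r : S × S => [[C], [r.1, r.2]])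
    ((D.finiteness C).subset ?_) ?_
  · rintro _ ⟨r, hr, rfl⟩
    exact ⟨rfl, by simpa using ⟨[], [], r.1, r.2, C, hr, rfl, rfl⟩⟩
  · rintro ⟨a, b⟩ _ ⟨a', b'⟩ _ h
    simpa using h

variable {D}

/-- The sequence through `[A', E]` shows that the set of two-step sequences to `[A, I, E]` is
nonempty; by associativity it then also contains one through some `[A, B]`. -/
theorem exists_dual_of_left {A I A' E Z : S} (h : D.R A I A') (h' : D.R A' E Z) :
    ∃ B, D.R I E B ∧ D.R A B Z := by
  have hmem : [A', E] ∈ {z | DegStep D.R [Z] z ∧ DegStep D.R z [A, I, E]} :=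
    ⟨⟨[], [], A', E, Z, h', rfl, rfl⟩, ⟨[], [E], A, I, A', h, rfl, rfl⟩⟩
  rcases D.associativity Z [A, I, E] with h0 | ⟨A₁, B₁, A₁', I₁, E₁, ht, hIE, -, -, hset⟩
  · rw [h0] at hmem
    exact hmem.elim
  · simp only [List.cons.injEq, and_true] at ht
    obtain ⟨rfl, rfl, rfl⟩ := ht
    have : [A, B₁] ∈ {z | DegStep D.R [Z] z ∧ DegStep D.R z [A, I, E]} := by
      rw [hset]
      exact Or.inl rfl
    exact ⟨B₁, hIE, degStep_singleton this.1⟩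

theorem exists_dual_of_right {A I B E Z : S} (h : D.R I E B) (h' : D.R A B Z) :
    ∃ A', D.R A I A' ∧ D.R A' E Z := by
  have hmem : [A, B] ∈ {z | DegStep D.R [Z] z ∧ DegStep D.R z [A, I, E]} :=
    ⟨⟨[], [], A, B, Z, h', rfl, rfl⟩, ⟨[A], [], I, E, B, h, rfl, rfl⟩⟩
  rcases D.associativity Z [A, I, E] with h0 | ⟨A₁, B₁, A₁', I₁, E₁, ht, -, hAI, -, hset⟩
  · rw [h0] at hmem
    exact hmem.elim
  · simp only [List.cons.injEq, and_true] at ht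
    obtain ⟨rfl, rfl, rfl⟩ := ht
    have : [A₁', E] ∈ {z | DegStep D.R [Z] z ∧ DegStep D.R z [A, I, E]} := by
      rw [hset]
      exact Or.inr rfl
    exact ⟨A₁', hAI, degStep_singleton this.1⟩

end DegenerationStructure

/-! # Factorizations of boundary points -/

namespace Operation

variable {X : Type u} [TopologicalSpace X] {Y : X → Type w}
  [∀ x, AddCommGroup (Y x)] [∀ x, Module ℝ (Y x)] {M : MPolyfold.{u, v} X}
  {b : StrongBundle.{u, v, w} M Y} {S : Type*} {D : DegenerationStructure S}
  (O : Operation b D)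

/-- `x = y ∘ z`. -/
def Factors (y z x : X) : Prop :=
  D.R (O.idx y) (O.idx z) (O.idx x) ∧ O.op (O.idx y) (O.idx z) (O.idx x) y z = x

variable {O}

theorem factors_op {y z : X} {C : S} (h : D.R (O.idx y) (O.idx z) C) :
    O.Factors y z (O.op (O.idx y) (O.idx z) C y z) := by
  have := O.idx_op _ _ _ h y z rfl rfl
  exact ⟨by rwa [this], by rw [this]⟩

theorem factors_iff {x y z : X} : O.Factors y z x ↔
    ∃ A B C, D.R A B C ∧ O.idx y = A ∧ O.idx z = B ∧ O.op A B C y z = x := by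
  refine ⟨fun h => ⟨_, _, _, h.1, rfl, rfl, h.2⟩, ?_⟩
  rintro ⟨_, _, C, h, rfl, rfl, rfl⟩
  exact factors_op h

theorem Factors.degen_eq {y z x : X} (h : O.Factors y z x) :
    M.degen x = M.degen y + M.degen z + 1 := by
  rw [← O.degen_op _ _ _ h.1 y z rfl rfl, h.2]

theorem Factors.eq_of_idx_eq {y z y' z' x : X} (h : O.Factors y z x) (h' : O.Factors y' z' x)
    (hy : O.idx y = O.idx y') (hz : O.idx z = O.idx z') : y = y' ∧ z = z' := by
  have hinj := (O.isClosedEmbedding_op _ _ _ h'.1).injective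
  have := @hinj (⟨y, hy⟩, ⟨z, hz⟩) (⟨y', rfl⟩, ⟨z', rfl⟩) (by
    have h1 := h.2.trans h'.2.symm
    rwa [hy, hz] at h1)
  exact ⟨congrArg (fun p => (p.1 : X)) this, congrArg (fun p => (p.2 : X)) this⟩

/-- This is `(y ∘ z) ∘ w = y ∘ (z ∘ w)`; the inner product on the right is available because the
dual relators exist. -/
theorem Factors.assoc_right {y z t w x : X} (h : O.Factors y z t) (h' : O.Factors t w x) :
    ∃ s, O.Factors z w s ∧ O.Factors y s x := by
  obtain ⟨B, hB, hB'⟩ := DegenerationStructure.exists_dual_of_left h.1 h'.1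
  refine ⟨_, factors_op hB, factors_iff.2 ⟨_, _, _, hB', rfl, O.idx_op _ _ _ hB _ _ rfl rfl, ?_⟩⟩
  rw [O.op_assoc _ _ _ _ _ _ hB hB' h.1 h'.1 y z w rfl rfl rfl, h.2, h'.2]

theorem Factors.assoc_left {y z w s x : X} (h : O.Factors z w s) (h' : O.Factors y s x) :
    ∃ t, O.Factors y z t ∧ O.Factors t w x := by
  obtain ⟨B, hB, hB'⟩ := DegenerationStructure.exists_dual_of_right h.1 h'.1
  refine ⟨_, factors_op hB, factors_iff.2 ⟨_, _, _, hB', O.idx_op _ _ _ hB _ _ rfl rfl, rfl, ?_⟩⟩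
  rw [← O.op_assoc _ _ _ _ _ _ h.1 h'.1 hB hB' y z w rfl rfl rfl, h.2, h'.2]

/-- A point of positive degeneration lies on a face, and each face is contained in the image of some
product. -/
theorem exists_factors (hM : M.FaceStructured) {x : X} (hx : 1 ≤ M.degen x) :
    ∃ y z, O.Factors y z x := by
  have hne : {F | M.IsFace F ∧ x ∈ F}.Nonempty := by
    rw [← encard_ne_zero, hM x]
    exact_mod_cast (by omega : M.degen x ≠ 0)
  obtain ⟨F, hF, hxF⟩ := hne
  obtain ⟨⟨A, B, C⟩, ⟨hR, hsub⟩, -⟩ := O.face_index F hF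
  obtain ⟨y, hy, z, hz, h⟩ := hsub hxF
  exact ⟨y, z, factors_iff.2 ⟨A, B, C, hR, hy, hz, h⟩⟩

/-- Starting from any factorization, the left factor is split if its degeneration is too large and
the right factor if it is too small; associativity regroups the result. -/
theorem exists_factors_degen_eq (hM : M.FaceStructured) (x : X) (i : ℕ) (hi : i < M.degen x) :
    ∃ y z, O.Factors y z x ∧ M.degen y = i := by
  induction hn : M.degen x using Nat.strong_induction_on generalizing x i with
  | _ n ih =>
    obtain ⟨y, z, h⟩ := exists_factors (O := O) hM (x := x) (by omega)
    have hd := h.degen_eq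
    rcases lt_trichotomy i (M.degen y) with hlt | heq | hgt
    · obtain ⟨p, q, hpq, hp⟩ := ih _ (by omega) y i hlt rfl
      obtain ⟨s, -, hs⟩ := hpq.assoc_right h
      exact ⟨p, s, hs, hp⟩
    · exact ⟨y, z, h, heq.symm⟩
    -- A product adds one to the sum of degenerations, so `y ∘ p` has degeneration `i` exactly when
    -- `p` has degeneration `i - 1 - M.degen y`.
    · obtain ⟨p, q, hpq, hp⟩ := ih _ (by omega) z (i - 1 - M.degen y) (by omega) rfl
      obtain ⟨t, ht, ht'⟩ := hpq.assoc_left h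
      exact ⟨t, q, ht', by have := ht.degen_eq; omega⟩

/-- A boundary point has at most one factorization with a prescribed degeneration of the left
factor: the factorizations inject into the faces through the point. -/
theorem Factors.eq_of_degen_eq (hM : M.FaceStructured) {y z y' z' x : X} (h : O.Factors y z x)
    (h' : O.Factors y' z' x) (hd : M.degen y = M.degen y') : y = y' ∧ z = z' := by
  let T := {p : X × X // O.Factors p.1 p.2 x}
  have hface : ∀ p : T, ∃ F : {F | M.IsFace F ∧ x ∈ F}, (F : Set X) ⊆
      image2 (O.op (O.idx p.1.1) (O.idx p.1.2) (O.idx x)) (O.idx ⁻¹' {O.idx p.1.1})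
        (O.idx ⁻¹' {O.idx p.1.2}) := fun p => by
    have hx : x ∈ image2 (O.op (O.idx p.1.1) (O.idx p.1.2) (O.idx x))
        (O.idx ⁻¹' {O.idx p.1.1}) (O.idx ⁻¹' {O.idx p.1.2}) := ⟨_, rfl, _, rfl, p.2.2⟩
    rw [O.face_union _ _ _ p.2.1] at hx
    obtain ⟨F, ⟨hF, hsub⟩, hxF⟩ := hx
    exact ⟨⟨F, hF, hxF⟩, hsub⟩
  choose Φ hΦ using hface
  -- A face determines its relator, and for a given relator the operation is injective.
  have hinj : Function.Injective Φ := fun p p' hpp' => by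
    obtain ⟨r, -, hr⟩ := O.face_index (Φ p) (Φ p).2.1
    have h1 := hr (O.idx p.1.1, O.idx p.1.2, O.idx x) ⟨p.2.1, hΦ p⟩
    have h2 := hr (O.idx p'.1.1, O.idx p'.1.2, O.idx x) ⟨p'.2.1, hpp' ▸ hΦ p'⟩
    have h3 := h1.trans h2.symm
    simp only [Prod.mk.injEq, and_true] at h3
    obtain ⟨h4, h5⟩ := p.2.eq_of_idx_eq p'.2 h3.1 h3.2
    exact Subtype.ext (Prod.ext h4 h5)
  have hfin : {F | M.IsFace F ∧ x ∈ F}.Finite := by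
    rw [← encard_lt_top_iff, hM x]
    exact ENat.natCast_lt_top _
  have := hfin.to_subtype
  have := Finite.of_injective Φ hinj
  have hcard : Nat.card T ≤ Nat.card (Fin (M.degen x)) := by
    refine (Nat.card_le_card_of_injective Φ hinj).trans ?_
    rw [Nat.card_coe_set_eq, ncard_def, hM x]
    simp
  -- There are at most `M.degen x` factorizations, and every left degeneration below `M.degen x`
  -- occurs, so `δ` is a surjection between finite sets that cannot identify two factorizations.
  let δ : T → Fin (M.degen x) := fun p => ⟨M.degen p.1.1, by have := p.2.degen_eq; omega⟩
  have hsurj : Function.Surjective δ := fun i => by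
    obtain ⟨p, q, hpq, hp⟩ := exists_factors_degen_eq (O := O) hM x i i.2
    exact ⟨⟨(p, q), hpq⟩, Fin.ext hp⟩
  have hbij := hsurj.bijective_of_nat_card_le hcard
  have := @hbij.1 ⟨(y, z), h⟩ ⟨(y', z'), h'⟩ (Fin.ext hd)
  exact ⟨congrArg (fun p => p.1.1) this, congrArg (fun p => p.1.2) this⟩

theorem mem_setOp_iff {Q : Set X} {x : X} :
    x ∈ O.setOp Q ↔ ∃ y z, O.Factors y z x ∧ y ∈ Q ∧ z ∈ Q := by
  constructor
  · rintro ⟨A, B, C, y, z, hR, hy, hyA, hz, hzB, h⟩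
    exact ⟨y, z, factors_iff.2 ⟨A, B, C, hR, hyA, hzB, h⟩, hy, hz⟩
  · rintro ⟨y, z, h, hy, hz⟩
    exact ⟨_, _, _, y, z, h.1, hy, rfl, hz, rfl, h.2⟩

theorem idx_eq_of_mem_connectedComponent {x y : X} (h : y ∈ connectedComponent x) :
    O.idx y = O.idx x :=
  O.idx_locallyConstant.apply_eq_of_isPreconnected isPreconnected_connectedComponent h
    mem_connectedComponent

theorem isClopen_idx (A : S) : IsClopen (O.idx ⁻¹' {A}) :=
  ⟨(O.idx_locallyConstant.isClosed_fiber A), (O.idx_locallyConstant.isOpen_fiber A)⟩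

/-- Moving the factors within their components moves the product within its component. -/
theorem Factors.op_mem_connectedComponent {y z x y' z' : X} (h : O.Factors y z x)
    (hy : y' ∈ connectedComponent y) (hz : z' ∈ connectedComponent z) :
    ∃ x' ∈ connectedComponent x, O.Factors y' z' x' := by
  have hiy := idx_eq_of_mem_connectedComponent (O := O) hy
  have hiz := idx_eq_of_mem_connectedComponent (O := O) hz
  refine ⟨O.op (O.idx y) (O.idx z) (O.idx x) y' z', ?_,
    factors_iff.2 ⟨_, _, _, h.1, hiy, hiz, rfl⟩⟩
  have hcont : ContinuousOn (fun p : X × X => O.op (O.idx y) (O.idx z) (O.idx x) p.1 p.2)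
      (connectedComponent y ×ˢ connectedComponent z) := by
    rw [continuousOn_iff_continuous_domRestrict]
    exact (O.isClosedEmbedding_op _ _ _ h.1).continuous.comp
      (f := fun p : ↥(connectedComponent y ×ˢ connectedComponent z) =>
        ((⟨p.1.1, idx_eq_of_mem_connectedComponent p.2.1⟩ : ↥(O.idx ⁻¹' {O.idx y})),
          (⟨p.1.2, idx_eq_of_mem_connectedComponent p.2.2⟩ : ↥(O.idx ⁻¹' {O.idx z}))))
      (by fun_prop)
  have hpre := (isPreconnected_connectedComponent (x := y)).prod
    (isPreconnected_connectedComponent (x := z)) |>.image _ hcont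
  refine hpre.subset_connectedComponent ?_ ⟨(y', z'), ⟨hy, hz⟩, rfl⟩
  exact ⟨(y, z), ⟨mem_connectedComponent, mem_connectedComponent⟩, h.2⟩

end Operation

/-! # Compatible neighbourhoods -/

/-- Recursive definition of a function whose value at `C` depends only on the values below `C`. -/
theorem WellFounded.exists_eq_of_local {S : Type*} {r : S → S → Prop} (hr : WellFounded r)
    {α : Type*} [Inhabited α] (F : S → (S → α) → α)
    (hF : ∀ C u u', (∀ A, r A C → u A = u' A) → F C u = F C u') : ∃ U : S → α, ∀ C, U C = F C U := by
  classical
  -- By locality of `F`, the value `default` away from the predecessors of `C` has no influence.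
  refine ⟨hr.fix fun C v => F C fun A => if h : r A C then v A h else default, fun C => ?_⟩
  rw [hr.fix_eq]
  refine hF C _ _ fun A hA => ?_
  rw [dif_pos hA]

namespace Operation

variable {X : Type u} [TopologicalSpace X] {Y : X → Type w}
  [∀ x, AddCommGroup (Y x)] [∀ x, Module ℝ (Y x)] {M : MPolyfold.{u, v} X}
  {b : StrongBundle.{u, v, w} M Y} {S : Type*} {D : DegenerationStructure S}
  (O : Operation b D)

/-- The points of `[C]` which are products of elements of the sets `U A`, `A ∈ S`. -/
def products (U : S → Set X) (C : S) : Set X :=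
  {x | O.idx x = C ∧ ∃ y z, O.Factors y z x ∧ y ∈ U (O.idx y) ∧ z ∈ U (O.idx z)}

/-- The set `U C` contains a product if and only if the corresponding sets contain the factors. -/
def StronglyCompatibleAt (U : S → Set X) (C : S) : Prop :=
  ∀ x y z, O.Factors y z x → O.idx x = C → (x ∈ U C ↔ y ∈ U (O.idx y) ∧ z ∈ U (O.idx z))

variable {O}

/-- Suppose `x = y ∘ z = y' ∘ z'` with `y` of smaller degeneration than `y'`. Splitting `y' = p ∘ q`
at the degeneration of `y`, uniqueness gives `y = p` and `z = q ∘ z'`. Compatibility below `C` then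
transfers membership; the opposite inequality is symmetric. -/
theorem factors_mem_of_mem_products (hM : M.FaceStructured) {U : S → Set X} {C : S}
    (hU : ∀ A, D.Below A C → O.StronglyCompatibleAt U A) {x y z : X} (h : O.Factors y z x)
    (hx : x ∈ O.products U C) : y ∈ U (O.idx y) ∧ z ∈ U (O.idx z) := by
  obtain ⟨rfl, y', z', h', hy', hz'⟩ := hx
  have hd := h.degen_eq
  have hd' := h'.degen_eq
  rcases lt_trichotomy (M.degen y) (M.degen y') with hlt | heq | hgt
  · obtain ⟨p, q, hpq, hp⟩ := exists_factors_degen_eq (O := O) hM y' (M.degen y) hlt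
    obtain ⟨t, ht, ht'⟩ := hpq.assoc_right h'
    obtain ⟨rfl, rfl⟩ := h.eq_of_degen_eq hM ht' hp.symm
    obtain ⟨h1, h2⟩ := (hU _ (DegenerationStructure.below_left h'.1) _ _ _ hpq rfl).1 hy'
    exact ⟨h1, (hU _ (DegenerationStructure.below_right h.1) _ _ _ ht rfl).2 ⟨h2, hz'⟩⟩
  · obtain ⟨rfl, rfl⟩ := h.eq_of_degen_eq hM h' heq
    exact ⟨hy', hz'⟩
  · obtain ⟨p, q, hpq, hp⟩ := exists_factors_degen_eq (O := O) hM y (M.degen y') hgt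
    obtain ⟨t, ht, ht'⟩ := hpq.assoc_right h
    obtain ⟨rfl, rfl⟩ := h'.eq_of_degen_eq hM ht' hp.symm
    obtain ⟨h1, h2⟩ := (hU _ (DegenerationStructure.below_right h'.1) _ _ _ ht rfl).1 hz'
    exact ⟨(hU _ (DegenerationStructure.below_left h.1) _ _ _ hpq rfl).2 ⟨hy', h1⟩, h2⟩

/-- Since membership is independent of the factorization, the set is a finite union of images, under
closed embeddings, of the closed sets of pairs with an inadmissible factor. -/
theorem isClosed_boundary_diff_products (hM : M.FaceStructured) {U : S → Set X} {C : S}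
    (hU : ∀ A, D.Below A C → O.StronglyCompatibleAt U A) (hopen : ∀ A, D.Below A C → IsOpen (U A)) :
    IsClosed {x | O.idx x = C ∧ 1 ≤ M.degen x ∧ x ∉ O.products U C} := by
  have heq : {x | O.idx x = C ∧ 1 ≤ M.degen x ∧ x ∉ O.products U C} =
      ⋃ r ∈ {r : S × S | D.R r.1 r.2 C},
        (fun p : ↥(O.idx ⁻¹' {r.1}) × ↥(O.idx ⁻¹' {r.2}) => O.op r.1 r.2 C p.1 p.2) ''
          {p | ¬ ((p.1 : X) ∈ U r.1 ∧ (p.2 : X) ∈ U r.2)} := by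
    ext x
    simp only [mem_iUnion, mem_ofPred_eq, exists_prop]
    constructor
    · rintro ⟨rfl, hd, hx⟩
      obtain ⟨y, z, h⟩ := exists_factors (O := O) hM hd
      exact ⟨(O.idx y, O.idx z), h.1, (⟨y, rfl⟩, ⟨z, rfl⟩),
        fun hyz => hx ⟨rfl, y, z, h, hyz⟩, h.2⟩
    · rintro ⟨⟨A, B⟩, hR, ⟨⟨y, hy⟩, ⟨z, hz⟩⟩, hyz, h⟩
      obtain rfl : O.idx y = A := hy
      obtain rfl : O.idx z = B := hz
      have hfac : O.Factors y z x := factors_iff.2 ⟨_, _, C, hR, rfl, rfl, h⟩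
      refine ⟨?_, ?_, fun hx => hyz (factors_mem_of_mem_products hM hU hfac hx)⟩
      · rw [← h]
        exact O.idx_op _ _ _ hR _ _ rfl rfl
      · rw [hfac.degen_eq]
        exact Nat.le_add_left _ _
  rw [heq]
  refine (D.finite_relators C).isClosed_biUnion fun r hr => ?_
  refine (O.isClosedEmbedding_op _ _ _ hr).isClosedMap _ ?_
  have h1 : IsOpen {p : ↥(O.idx ⁻¹' {r.1}) × ↥(O.idx ⁻¹' {r.2}) |
      (p.1 : X) ∈ U r.1 ∧ (p.2 : X) ∈ U r.2} :=
    ((hopen _ (DegenerationStructure.below_left hr)).preimage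
      (continuous_subtype_val.comp continuous_fst)).inter
    ((hopen _ (DegenerationStructure.below_right hr)).preimage
      (continuous_subtype_val.comp continuous_snd))
  exact h1.isClosed_compl

/-- If a set is relatively compact in every connected component, then so is its intersection with
the union of the components meeting a compact set. -/
theorem exists_isCompact_of_componentwise [LocallyConnectedSpace X] {Q P : Set X}
    (hP : IsCompact P) (hQ : ∀ p ∈ P, ∃ K, IsCompact K ∧ connectedComponent p ∩ Q ⊆ K) :
    ∃ K, IsCompact K ∧ ∀ x ∈ Q, ∀ p ∈ P, x ∈ connectedComponent p → x ∈ K := by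
  obtain ⟨t, htP, ht⟩ := hP.elim_nhds_subcover connectedComponent
    fun p _ => isOpen_connectedComponent.mem_nhds mem_connectedComponent
  choose! K hK hsub using hQ
  refine ⟨⋃ p ∈ t, K p, t.isCompact_biUnion fun p hp => hK p (htP p hp), fun x hx p hp hxp => ?_⟩
  obtain ⟨p', hp', hpp'⟩ := mem_iUnion₂.1 (ht hp)
  rw [← connectedComponent_eq hpp'] at hxp
  exact mem_iUnion₂.2 ⟨p', hp', hsub p' (htP p' hp') ⟨hxp, hx⟩⟩

/-- If below `C` the sets `U B ∩ A` are componentwise relatively compact, and contained in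
components meeting the componentwise compact set `Z`, then the products in `[C] ∩ A` are
componentwise relatively compact. -/
theorem exists_isCompact_products [LocallyConnectedSpace X] {Z A : Set X}
    (hZ : ∀ x, IsCompact (connectedComponent x ∩ Z))
    (hZfac : ∀ y z x, O.Factors y z x → (x ∈ Z ↔ y ∈ Z ∧ z ∈ Z))
    (hAfac : ∀ y z x, O.Factors y z x → x ∈ A → y ∈ A ∧ z ∈ A) {U : S → Set X} {C : S}
    (hcpt : ∀ B, D.Below B C → ∀ x, O.idx x = B →
      ∃ K, IsCompact K ∧ connectedComponent x ∩ (U B ∩ A) ⊆ K)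
    (hmeet : ∀ B, D.Below B C → ∀ x, O.idx x = B → x ∈ U B → x ∈ A →
      (connectedComponent x ∩ Z).Nonempty) (x : X) :
    ∃ K, IsCompact K ∧ connectedComponent x ∩ (A ∩ O.products U C) ⊆ K := by
  have hpair : ∀ r ∈ {r : S × S | D.R r.1 r.2 C}, ∃ K, IsCompact K ∧ ∀ x' y z, O.Factors y z x' →
      O.idx y = r.1 → O.idx z = r.2 → O.idx x' = C → y ∈ U r.1 → z ∈ U r.2 → x' ∈ A →
      x' ∈ connectedComponent x → x' ∈ K := fun r hr => by
    have hemb := O.isClosedEmbedding_op _ _ _ hr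
    set op' := fun p : ↥(O.idx ⁻¹' {r.1}) × ↥(O.idx ⁻¹' {r.2}) => O.op r.1 r.2 C p.1 p.2
    -- The pairs whose product is a zero in the component of `x` form a compact set, so their
    -- factors meet only finitely many components.
    have hC₀ := hemb.isCompact_preimage (hZ x)
    have hfst : IsCompact ((fun p : ↥(O.idx ⁻¹' {r.1}) × ↥(O.idx ⁻¹' {r.2}) => (p.1 : X)) ''
      (op' ⁻¹' (connectedComponent x ∩ Z))) := hC₀.image (by fun_prop)
    have hsnd : IsCompact ((fun p : ↥(O.idx ⁻¹' {r.1}) × ↥(O.idx ⁻¹' {r.2}) => (p.2 : X)) ''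
      (op' ⁻¹' (connectedComponent x ∩ Z))) := hC₀.image (by fun_prop)
    obtain ⟨K₁, hK₁, hsub₁⟩ := exists_isCompact_of_componentwise (Q := U r.1 ∩ A) hfst (by
      rintro _ ⟨p, -, rfl⟩
      exact hcpt _ (DegenerationStructure.below_left hr) _ p.1.2)
    obtain ⟨K₂, hK₂, hsub₂⟩ := exists_isCompact_of_componentwise (Q := U r.2 ∩ A) hsnd (by
      rintro _ ⟨p, -, rfl⟩
      exact hcpt _ (DegenerationStructure.below_right hr) _ p.2.2)
    have hK₁' := (isClopen_idx (O := O) r.1).1.isClosedEmbedding_subtypeVal.isCompact_preimage hK₁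
    have hK₂' := (isClopen_idx (O := O) r.2).1.isClosedEmbedding_subtypeVal.isCompact_preimage hK₂
    refine ⟨op' '' _, (hK₁'.prod hK₂').image hemb.continuous, ?_⟩
    intro x' y z hfac hy hz hx' hyU hzU hxA hxx'
    obtain ⟨hyA, hzA⟩ := hAfac _ _ _ hfac hxA
    -- Both factors are moved to zeros in their components. The product of these zeros is a zero in
    -- the component of `x`, which places `y` and `z` in the finitely many components controlled
    -- above.
    obtain ⟨y₁, hy₁, hy₁Z⟩ := hmeet _ (DegenerationStructure.below_left hr) y hy hyU hyA
    obtain ⟨z₁, hz₁, hz₁Z⟩ := hmeet _ (DegenerationStructure.below_right hr) z hz hzU hzA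
    obtain ⟨w, hw, hwfac⟩ := hfac.op_mem_connectedComponent hy₁ hz₁
    have hiy : O.idx y₁ = r.1 := (idx_eq_of_mem_connectedComponent hy₁).trans hy
    have hiz : O.idx z₁ = r.2 := (idx_eq_of_mem_connectedComponent hz₁).trans hz
    have hiw : O.idx w = C := (idx_eq_of_mem_connectedComponent hw).trans hx'
    have hw' : O.op r.1 r.2 C y₁ z₁ = w := by
      have := hwfac.2
      rwa [hiy, hiz, hiw] at this
    have hmem : ((⟨y₁, hiy⟩, ⟨z₁, hiz⟩) : ↥(O.idx ⁻¹' {r.1}) × ↥(O.idx ⁻¹' {r.2})) ∈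
        op' ⁻¹' (connectedComponent x ∩ Z) := by
      change O.op r.1 r.2 C y₁ z₁ ∈ connectedComponent x ∩ Z
      rw [hw', connectedComponent_eq hxx']
      exact ⟨hw, (hZfac _ _ _ hwfac).2 ⟨hy₁Z, hz₁Z⟩⟩
    refine ⟨(⟨y, hy⟩, ⟨z, hz⟩), ⟨?_, ?_⟩, ?_⟩
    · refine hsub₁ y ⟨hyU, hyA⟩ y₁ ⟨_, hmem, rfl⟩ ?_
      rw [← connectedComponent_eq hy₁]
      exact mem_connectedComponent
    · refine hsub₂ z ⟨hzU, hzA⟩ z₁ ⟨_, hmem, rfl⟩ ?_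
      rw [← connectedComponent_eq hz₁]
      exact mem_connectedComponent
    · have := hfac.2
      rwa [hy, hz, hx'] at this
  choose! K hK hsub using hpair
  refine ⟨_, (D.finite_relators C).isCompact_biUnion hK, ?_⟩
  rintro x' ⟨hxx', hxA, hiC, y, z, hfac, hy, hz⟩
  have hr : (O.idx y, O.idx z) ∈ {r : S × S | D.R r.1 r.2 C} := hiC ▸ hfac.1
  exact mem_iUnion₂.2 ⟨_, hr, hsub _ hr x' y z hfac rfl rfl hiC hy hz hxA hxx'⟩

/-- If `A` is a closed, locally compact set which contains, with a product, also its factors, and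
`Z` is componentwise compact and contains a product if and only if it contains its factors, then there is a compatible open neighbourhood of `Z` whose intersection with `A` is componentwise
relatively compact. -/
theorem exists_compatible_nhds [LocallyConnectedSpace X] [T2Space X] (hM : M.FaceStructured)
    {Z A : Set X} (hA : IsClosed A)
    (hloc : ∀ L : Set X, IsCompact L → ∃ V, IsOpen V ∧ L ⊆ V ∧ ∃ K, IsCompact K ∧ V ∩ A ⊆ K)
    (hZ : ∀ x, IsCompact (connectedComponent x ∩ Z))
    (hZfac : ∀ y z x, O.Factors y z x → (x ∈ Z ↔ y ∈ Z ∧ z ∈ Z))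
    (hAfac : ∀ y z x, O.Factors y z x → x ∈ A → y ∈ A ∧ z ∈ A) :
    ∃ U, IsOpen U ∧ Z ⊆ U ∧ O.CompatibleSet U ∧
      ∀ x, ∃ K, IsCompact K ∧ connectedComponent x ∩ (U ∩ A) ⊆ K := by
  have hnb : ∀ L : Set X, ∃ V, IsOpen V ∧ (IsCompact L → L ⊆ V ∧ ∃ K, IsCompact K ∧ V ∩ A ⊆ K) ∧
      (L = ∅ → V = ∅) := fun L => by
    by_cases hL : IsCompact L
    · by_cases h0 : L = ∅
      · subst h0
        exact ⟨∅, isOpen_empty, fun _ => ⟨Subset.rfl, ∅, isCompact_empty, by simp⟩, fun _ => rfl⟩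
      · obtain ⟨V, h1, h2⟩ := hloc L hL
        exact ⟨V, h1, fun _ => h2, fun h => absurd h h0⟩
    · exact ⟨∅, isOpen_empty, fun h => absurd h hL, fun _ => rfl⟩
  choose nb hnbo hnbc hnbe using hnb
  let L : (S → Set X) → S → X → Set X := fun u C x =>
    closure (connectedComponent x ∩ (Z ∪ A ∩ O.products u C))
  -- Points outside `A` face no neighbourhood condition. Products lying in `A` belong to `L`, hence
  -- satisfy it automatically; this gives compatibility.
  obtain ⟨U, hUeq⟩ := D.wellFounded_below.exists_eq_of_local (α := Set X)
    (fun C u => {x | O.idx x = C ∧ (1 ≤ M.degen x → x ∈ O.products u C) ∧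
      (x ∈ A → x ∈ nb (L u C x))}) (fun C u u' huu' => by
    have : O.products u C = O.products u' C := by
      ext x
      refine and_congr_right fun hx => exists₂_congr fun y z => and_congr_right fun h => ?_
      have hR := hx ▸ h.1
      rw [huu' _ (DegenerationStructure.below_left hR),
        huu' _ (DegenerationStructure.below_right hR)]
    simp only [L, this])
  have key : ∀ C, IsOpen (U C) ∧ (∀ x, O.idx x = C → x ∈ Z → x ∈ U C) ∧
      O.StronglyCompatibleAt U C ∧
      (∀ x, O.idx x = C → ∃ K, IsCompact K ∧ connectedComponent x ∩ (U C ∩ A) ⊆ K) ∧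
      ∀ x, O.idx x = C → x ∈ U C → x ∈ A → (connectedComponent x ∩ Z).Nonempty := by
    intro C
    induction C using D.wellFounded_below.induction with
    | _ C ih =>
    have hmem : ∀ x, x ∈ U C ↔ O.idx x = C ∧ (1 ≤ M.degen x → x ∈ O.products U C) ∧
        (x ∈ A → x ∈ nb (L U C x)) := fun x => by
      conv_lhs => rw [hUeq C]
      rfl
    have hcompat : ∀ B, D.Below B C → O.StronglyCompatibleAt U B := fun B hB => (ih B hB).2.2.1
    have hLc : ∀ x, IsCompact (L U C x) := fun x => by
      obtain ⟨K, hK, hsub⟩ := exists_isCompact_products hZ hZfac hAfac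
        (fun B hB => (ih B hB).2.2.2.1) (fun B hB => (ih B hB).2.2.2.2) x
      refine ((hZ x).union hK).closure_of_subset ?_
      rw [inter_union_distrib_left]
      exact union_subset_union_right _ hsub
    have hLeq : ∀ {x y}, y ∈ connectedComponent x → L U C y = L U C x := fun h => by
      simp only [L, connectedComponent_eq h]
    have hL : ∀ x, x ∈ Z ∪ A ∩ O.products U C → x ∈ nb (L U C x) := fun x hx =>
      (hnbc _ (hLc x)).1 (subset_closure ⟨mem_connectedComponent, hx⟩)
    refine ⟨?_, ?_, ?_, ?_, ?_⟩
    · have hset : U C = O.idx ⁻¹' {C} ∩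
          ({x | O.idx x = C ∧ 1 ≤ M.degen x ∧ x ∉ O.products U C}ᶜ ∩
            (Aᶜ ∪ {x | x ∈ nb (L U C x)})) := by
        ext x
        rw [hmem]
        simp only [mem_inter_iff, mem_preimage, mem_singleton_iff, mem_compl_iff, mem_ofPred_eq,
          mem_union]
        tauto
      rw [hset]
      refine (isClopen_idx C).2.inter ((isClosed_boundary_diff_products hM hcompat
        fun B hB => (ih B hB).1).isOpen_compl.inter (hA.isOpen_compl.union ?_))
      -- The chosen neighbourhood depends only on the component, and components are open.
      refine isOpen_iff_mem_nhds.2 fun x hx => ?_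
      filter_upwards [(hnbo _).mem_nhds hx, isOpen_connectedComponent.mem_nhds
        (mem_connectedComponent (x := x))] with y hy hyx
      rwa [hLeq hyx]
    · intro x hx hxZ
      refine (hmem x).2 ⟨hx, fun hd => ?_, fun _ => hL x (Or.inl hxZ)⟩
      obtain ⟨y, z, h⟩ := exists_factors (O := O) hM hd
      obtain ⟨hy, hz⟩ := (hZfac _ _ _ h).1 hxZ
      have hR := hx ▸ h.1
      exact ⟨hx, y, z, h, (ih _ (DegenerationStructure.below_left hR)).2.1 y rfl hy,
        (ih _ (DegenerationStructure.below_right hR)).2.1 z rfl hz⟩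
    · intro x y z h hx
      constructor
      · intro hxU
        refine factors_mem_of_mem_products hM hcompat h (((hmem x).1 hxU).2.1 ?_)
        rw [h.degen_eq]
        exact Nat.le_add_left _ _
      · intro hyz
        have hxp : x ∈ O.products U C := ⟨hx, y, z, h, hyz⟩
        exact (hmem x).2 ⟨hx, fun _ => hxp, fun hxA => hL x (Or.inr ⟨hxA, hxp⟩)⟩
    · intro x _
      obtain ⟨-, K, hK, hsub⟩ := hnbc _ (hLc x)
      refine ⟨K, hK, ?_⟩
      rintro y ⟨hyx, hyU, hyA⟩
      refine hsub ⟨?_, hyA⟩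
      rw [← hLeq hyx]
      exact ((hmem y).1 hyU).2.2 hyA
    · intro x _ hxU hxA
      have hxnb := ((hmem x).1 hxU).2.2 hxA
      -- An admitted point of `A` forces its component to contain a zero or a product in `A`. In the
      -- second case the factors are moved to zeros, and their product is a zero in the same
      -- component.
      have hne : (connectedComponent x ∩ (Z ∪ A ∩ O.products U C)).Nonempty := by
        rw [← closure_nonempty_iff, nonempty_iff_ne_empty]
        intro h0
        rw [hnbe _ h0] at hxnb
        exact hxnb
      obtain ⟨x', hx', hx'Z | ⟨hx'A, hiC, y, z, h, hy, hz⟩⟩ := hne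
      · exact ⟨x', hx', hx'Z⟩
      · have hR := hiC ▸ h.1
        obtain ⟨hyA, hzA⟩ := hAfac _ _ _ h hx'A
        obtain ⟨y₁, hy₁, hy₁Z⟩ := (ih _ (DegenerationStructure.below_left hR)).2.2.2.2 y rfl hy hyA
        obtain ⟨z₁, hz₁, hz₁Z⟩ := (ih _ (DegenerationStructure.below_right hR)).2.2.2.2 z rfl hz hzA
        obtain ⟨w, hw, hwfac⟩ := h.op_mem_connectedComponent hy₁ hz₁
        exact ⟨w, by rwa [connectedComponent_eq hx'], (hZfac _ _ _ hwfac).2 ⟨hy₁Z, hz₁Z⟩⟩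
  have hidx : ∀ {C x}, x ∈ U C → O.idx x = C := fun {C x} hx => by
    rw [hUeq C] at hx
    exact hx.1
  have hmemU : ∀ {x}, x ∈ ⋃ C, U C ↔ x ∈ U (O.idx x) := fun {x} =>
    ⟨fun h => by obtain ⟨C, hC⟩ := mem_iUnion.1 h; rwa [hidx hC], fun h => mem_iUnion.2 ⟨_, h⟩⟩
  refine ⟨⋃ C, U C, isOpen_iUnion fun C => (key C).1,
    fun x hx => hmemU.2 ((key _).2.1 x rfl hx), ?_, fun x => ?_⟩
  · ext x
    rw [mem_setOp_iff]
    constructor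
    · rintro ⟨hxU, hd⟩
      obtain ⟨y, z, h⟩ := exists_factors (O := O) hM hd
      obtain ⟨hy, hz⟩ := ((key _).2.2.1 x y z h rfl).1 (hmemU.1 hxU)
      exact ⟨y, z, h, hmemU.2 hy, hmemU.2 hz⟩
    · rintro ⟨y, z, h, hy, hz⟩
      refine ⟨hmemU.2 (((key _).2.2.1 x y z h rfl).2 ⟨hmemU.1 hy, hmemU.1 hz⟩), ?_⟩
      change 1 ≤ M.degen x
      rw [h.degen_eq]
      exact Nat.le_add_left _ _
  · obtain ⟨K, hK, hsub⟩ := (key _).2.2.2.1 x rfl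
    refine ⟨K, hK, fun y hy => hsub ⟨hy.1, ?_, hy.2.2⟩⟩
    rw [← idx_eq_of_mem_connectedComponent (O := O) hy.1]
    exact hmemU.1 hy.2.1

end Operation

/-! # Sections and the operation -/

namespace Operation

variable {X : Type u} [TopologicalSpace X] {Y : X → Type w}
  [∀ x, AddCommGroup (Y x)] [∀ x, Module ℝ (Y x)] {M : MPolyfold.{u, v} X}
  {b : StrongBundle.{u, v, w} M Y} {S : Type*} {D : DegenerationStructure S}
  {O : Operation b D}

/-- The inverse of the operation is strongly smooth in charts, hence it preserves fibre level one.
-/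
theorem inLevel_of_inLevel_fop {A B C : S} (hR : D.R A B C) {x y : X} (hx : O.idx x = A)
    (hy : O.idx y = B) {h : Y x} {k : Y y} (hl : b.InLevel 1 (O.fop A B C x y (h, k))) :
    b.InLevel 1 h ∧ b.InLevel 1 k := by
  obtain ⟨c₁, hc₁, c₂, hc₂, c₃, hc₃, hxs, hys, hzs, V, g₁, g₂, k₁, k₂, -, hV, -, -, hk₁, hk₂, hinv⟩ :=
    O.smooth_inverse A B C hR x y hx hy
  obtain ⟨-, -, hlin⟩ := hinv x y hx hy hxs hys hzs hV
  obtain ⟨e, he⟩ := hl.exists_lin_eq hc₃ hzs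
  obtain ⟨h1, h2⟩ := hlin h k
  obtain ⟨m₁, hm₁, -⟩ := hk₁.exists_continuousOn
  obtain ⟨m₂, hm₂, -⟩ := hk₂.exists_continuousOn
  have hmem := And.intro hV (c₃.base.map_mem_dom hzs)
  refine ⟨⟨c₁, hc₁, hxs, m₁ (c₃.base.φ (O.op A B C x y)) e, ?_⟩,
    ⟨c₂, hc₂, hys, m₂ (c₃.base.φ (O.op A B C x y)) e, ?_⟩⟩
  · rw [hm₁ _ hmem, he, h1]
  · rw [hm₂ _ hmem, he, h2]

/-- The maximum formula for `N` bounds each factor by the product, once both factors are known to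
have level one. -/
theorem CompatibleSection.mem_subunitSet {f : ∀ x, Y x} (hf : O.CompatibleSection f)
    {N : ∀ x, Y x → ℝ≥0} (hN : O.IsAuxiliaryNorm N) {y z x : X} (h : O.Factors y z x)
    (hx : x ∈ b.subunitSet f N) : y ∈ b.subunitSet f N ∧ z ∈ b.subunitSet f N := by
  obtain ⟨hR, hop⟩ := h
  rw [← hop] at hx
  obtain ⟨hl, hle⟩ := hx
  have hfyz := hf _ _ _ hR y z rfl rfl
  rw [hfyz] at hl hle
  obtain ⟨hy, hz⟩ := inLevel_of_inLevel_fop hR rfl rfl hl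
  rw [hN.max _ _ _ hR y z rfl rfl _ _ hy hz] at hle
  exact ⟨⟨hy, (le_max_left _ _).trans hle⟩, ⟨hz, (le_max_right _ _).trans hle⟩⟩

theorem CompatibleSection.eq_zero_iff {f : ∀ x, Y x} (hf : O.CompatibleSection f) {y z x : X}
    (h : O.Factors y z x) : f x = 0 ↔ f y = 0 ∧ f z = 0 := by
  obtain ⟨hR, hop⟩ := h
  have h1 : f x = 0 ↔ f (O.op (O.idx y) (O.idx z) (O.idx x) y z) = 0 := by rw [hop]
  rw [h1, hf _ _ _ hR y z rfl rfl, LinearEquiv.map_eq_zero_iff, Prod.mk_eq_zero]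

theorem CompatibleSection.add {f s : ∀ x, Y x} (hf : O.CompatibleSection f)
    (hs : O.CompatibleSection s) : O.CompatibleSection (f + s) := fun A B C hR x y hx hy => by
  rw [Pi.add_apply, hf A B C hR x y hx hy, hs A B C hR x y hx hy, ← map_add]
  rfl

end Operation

/-! ### The perturbation theorem -/

theorem mainTheorem7 {X : Type u} [TopologicalSpace X] [TopologicalSpace.MetrizableSpace X]
    [SecondCountableTopology X]
    {Y : X → Type w} [∀ x, AddCommGroup (Y x)] [∀ x, Module ℝ (Y x)]
    (M : MPolyfold.{u, v} X) (hM : M.FaceStructured)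
    (b : StrongBundle.{u, v, w} M Y) (hb : b.IsHilbert)
    {S : Type*} (D : DegenerationStructure S) (O : Operation b D)
    (f : ∀ x, Y x) (hf : b.IsFredholm f) (hfO : O.CompatibleSection f)
    (hprop : ComponentwiseProper f)
    (N : ∀ x, Y x → ℝ≥0) (hN : O.IsAuxiliaryNorm N) :
    ∃ U : Set X, IsOpen U ∧ {x | f x = 0} ⊆ U ∧ O.CompatibleSet U ∧
      ∀ s : ∀ x, Y x, b.IsScPlusSection s → O.CompatibleSection s →
        closure {x | s x ≠ 0} ⊆ U → (∀ x, N x (s x) ≤ 1) →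
        O.CompatibleSection (f + s) ∧ ComponentwiseProper (f + s) := by
  have := M.locallyConnectedSpace
  have hclosed : IsClosed (b.subunitSet f N) := StrongBundle.isClosed_subunitSet hb hN hf.1
  obtain ⟨U, hU, hZU, hcompat, hK⟩ := Operation.exists_compatible_nhds (O := O) hM hclosed
    (fun L hL => exists_open_nhds_of_isCompact hclosed
      (fun q => (hf.2.2.2 q).exists_nhds_ultrafilter hN) hL) hprop
    (fun y z x h => hfO.eq_zero_iff h) (fun y z x h => hfO.mem_subunitSet hN h)
  refine ⟨U, hU, hZU, hcompat, fun s hs hsO hsupp hsN => ⟨hfO.add hsO, fun x => ?_⟩⟩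
  obtain ⟨K, hKc, hKsub⟩ := hK x
  refine hKc.of_isClosed_subset (isClosed_connectedComponent.inter
    (StrongBundle.isClosed_zeros_add hf.1 hs)) fun y hy => hKsub ⟨hy.1, ?_, ?_⟩
  · by_cases hsy : s y = 0
    · refine hZU (show f y = 0 from ?_)
      have h0 : f y + s y = 0 := hy.2
      rwa [hsy, add_zero] at h0
    · exact hsupp (subset_closure hsy)
  · have h0 : f y = -s y := eq_neg_of_add_eq_zero_left hy.2
    refine ⟨?_, ?_⟩
    · rw [h0, ← neg_one_smul ℝ]
      exact (hs.inLevel y).smul _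
    · rw [h0, hN.neg (hs.inLevel y)]
      exact hsN y
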